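/- Let $\Omega\subset\mathbb R^N$ be an open set and let $\mathring H^1(\Omega)$ be the closure of $C_c^\infty(\Omega)$ (complex valued functions) in the norm $\left(\int_\Omega(|u|^2+|\nabla u|^2)\,dx\right)^{1/2}$. Let $\mathscr A$ be an $N\times N$ matrix function on $\Omega$ with complex valued entries in $L^\infty(\Omega)$, let $\mathscr A^*$ be its adjoint (conjugate transpose) matrix, let $Eu=\nabla(\mathscr A\nabla u)$, and let $\langle\cdot,\cdot\rangle$ be the standard inner product of $\mathbb C^N$ (conjugate linear in the second argument). Let $\varphi:(0,+\infty)\to(0,+\infty)$ satisfy: 1. $\varphi\in C^1((0,+\infty))$; 2. $(s\,\varphi(s))'>0$ for every $s>0$; 3. the range of $s\,\varphi(s)$, $s>0$, is $(0,+\infty)$; 4. there are constants $C_1,C_2>0$, $s_0>0$ and a real number $r>-1$ such that $C_1s^r\le(s\,\varphi(s))'\le C_2s^r$ for $s\in(0,s_0)$; if $r=0$, moreover, the finite limit $\lim_{s\to0^+}\varphi(s)$ exists and is positive, and $\lim_{s\to0^+}s\,\varphi'(s)=0$. Let $\zeta$ be the inverse of the bijection $s\mapsto s\sqrt{\varphi(s)}$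 of $(0,+\infty)$ onto itself, and put $\Theta(t)=\zeta(t)/t$ and $\Lambda(t)=t\,\Theta'(t)/\Theta(t)$ for $t>0$. Let $\varphi(|u|)\,u$ be taken to be zero where $u$ vanishes. The operator $E$ is called $L^\Phi$-dissipative if $$\Re\int_\Omega\langle\mathscr A\nabla u,\nabla(\varphi(|u|)\,u)\rangle\,dx\ge0$$ for every $u\in\mathring H^1(\Omega)$ such that $\varphi(|u|)\,u\in\mathring H^1(\Omega)$. Lemma. $E$ is $L^\Phi$-dissipative if and only if, for every $v\in\mathring H^1(\Omega)$, $$\Re\int_\Omega\Big[\langle\mathscr A\nabla v,\nabla v\rangle+\Lambda(|v|)\,\langle(\mathscr A-\mathscr A^*)\nabla|v|,\,|v|^{-1}\overline v\,\nabla v\rangle-\Lambda^2(|v|)\,\langle\mathscr A\nabla|v|,\nabla|v|\rangle\Big]dx\ge0,$$ where the integrand is extended by zero on the set where $v$ vanishes. -/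

import Mathlib

open MeasureTheory Set Filter Topology TopologicalSpace Matrix
open scoped ENNReal

noncomputable section

namespace FunctionalDissipativity

/-- The space `ℝ^N`. -/
abbrev Space (N : ℕ) : Type := EuclideanSpace ℝ (Fin N)

/-- The classical `i`-th partial derivative of a complex valued function. -/
def partialDeriv {N : ℕ} (i : Fin N) (f : Space N → ℂ) (x : Space N) : ℂ :=
  fderiv ℝ f x (EuclideanSpace.single i (1 : ℝ))

/-- `g` is a weak gradient of `u` in the open set `Ω`: both are locally integrable in `Ω`, and
`∫_Ω u ∂ᵢf = - ∫_Ω gᵢ f` for every complex valued `f ∈ C_c^∞(Ω)` and every `i`.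
(`TestFunction Ω ℂ ⊤` is the space of smooth functions with compact support in `Ω`.) -/
def HasWeakGradient {N : ℕ} (Ω : Opens (Space N)) (u : Space N → ℂ)
    (g : Space N → Fin N → ℂ) : Prop :=
  LocallyIntegrableOn u (Ω : Set (Space N)) volume ∧
  ∀ i : Fin N, LocallyIntegrableOn (fun x => g x i) (Ω : Set (Space N)) volume ∧
    ∀ f : TestFunction Ω ℂ (⊤ : ℕ∞),
      ∫ x in (Ω : Set (Space N)), u x * partialDeriv i f x =
        - ∫ x in (Ω : Set (Space N)), g x i * f x

open Classical in
/-- The weak gradient `∇u` of `u` in `Ω` (unique almost everywhere in `Ω` when it exists; the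
value is `0` if `u` has no weak gradient). -/
def weakGrad {N : ℕ} (Ω : Opens (Space N)) (u : Space N → ℂ) : Space N → Fin N → ℂ :=
  if h : ∃ g, HasWeakGradient Ω u g then h.choose else 0

/-- `u ∈ H̊¹(Ω)`: `u` and its weak gradient are in `L²(Ω)`, and `u` is the limit, in the norm
`∫_Ω (|u|² + |∇u|²)`, of a sequence of functions of `C_c^∞(Ω)`. -/
def MemH10 {N : ℕ} (Ω : Opens (Space N)) (u : Space N → ℂ) : Prop :=
  MemLp u 2 (volume.restrict (Ω : Set (Space N))) ∧
  (∃ g, HasWeakGradient Ω u g) ∧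
  (∀ i, MemLp (fun x => weakGrad Ω u x i) 2 (volume.restrict (Ω : Set (Space N)))) ∧
  ∃ f : ℕ → TestFunction Ω ℂ (⊤ : ℕ∞),
    Tendsto (fun n => eLpNorm (fun x => f n x - u x) 2 (volume.restrict (Ω : Set (Space N))))
      atTop (𝓝 0) ∧
    ∀ i, Tendsto (fun n => eLpNorm (fun x => partialDeriv i (f n) x - weakGrad Ω u x i) 2
      (volume.restrict (Ω : Set (Space N)))) atTop (𝓝 0)

/-- The conditions on the positive function `φ` on `(0, ∞)`; the values of `φ` outside `(0, ∞)`
are irrelevant. -/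
structure Admissible (φ : ℝ → ℝ) : Prop where
  pos : ∀ s, 0 < s → 0 < φ s
  contDiffOn : ContDiffOn ℝ 1 φ (Ioi 0)
  deriv_pos : ∀ s, 0 < s → 0 < deriv (fun σ => σ * φ σ) s
  range_eq : (fun s => s * φ s) '' Ioi 0 = Ioi 0
  near_zero : ∃ C₁ C₂ r s₀ : ℝ, 0 < C₁ ∧ 0 < C₂ ∧ -1 < r ∧ 0 < s₀ ∧
    (∀ s ∈ Ioo 0 s₀, C₁ * s ^ r ≤ deriv (fun σ => σ * φ σ) s ∧
      deriv (fun σ => σ * φ σ) s ≤ C₂ * s ^ r) ∧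
    (r = 0 →
      (∃ φ₀ : ℝ, 0 < φ₀ ∧ Tendsto φ (𝓝[>] 0) (𝓝 φ₀)) ∧
      Tendsto (fun s => s * deriv φ s) (𝓝[>] 0) (𝓝 0))

/-- `ζ`, the inverse of the bijection `s ↦ s √(φ(s))` of `(0, ∞)` onto itself. -/
def zeta (φ : ℝ → ℝ) : ℝ → ℝ :=
  Function.invFunOn (fun s => s * √(φ s)) (Ioi 0)

/-- `Θ(t) = ζ(t) / t`. -/
def Theta (φ : ℝ → ℝ) (t : ℝ) : ℝ := zeta φ t / t

/-- `Λ(t) = t Θ'(t) / Θ(t)`. -/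
def Lambda (φ : ℝ → ℝ) (t : ℝ) : ℝ := t * deriv (Theta φ) t / Theta φ t

/-- The inner product `⟨ξ, η⟩ = ∑ᵢ ξᵢ \bar ηᵢ` of `ℂ^N`. -/
def cinner {N : ℕ} (ξ η : Fin N → ℂ) : ℂ := ∑ i, ξ i * star (η i)

/-- The entries of the matrix function `A` belong to `L^∞(Ω)`. -/
def BoundedCoefficients {N : ℕ} (Ω : Opens (Space N))
    (A : Space N → Matrix (Fin N) (Fin N) ℂ) : Prop :=
  ∀ h k, MemLp (fun x => A x h k) ∞ (volume.restrict (Ω : Set (Space N)))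

/-- The function `φ(|u|) u` (zero where `u` vanishes). -/
def phiMul {N : ℕ} (φ : ℝ → ℝ) (u : Space N → ℂ) (x : Space N) : ℂ :=
  (φ ‖u x‖ : ℂ) * u x

/-- The modulus `|v|`, as a complex valued function. -/
def modulus {N : ℕ} (v : Space N → ℂ) (x : Space N) : ℂ := (‖v x‖ : ℂ)

/-- The operator `Eu = ∇(A∇u)` is `L^Φ`-dissipative:
`Re ∫_Ω ⟨A∇u, ∇(φ(|u|)u)⟩ dx ≥ 0` for every `u ∈ H̊¹(Ω)` such that `φ(|u|)u ∈ H̊¹(Ω)`. -/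
def LPhiDissipative {N : ℕ} (Ω : Opens (Space N))
    (A : Space N → Matrix (Fin N) (Fin N) ℂ) (φ : ℝ → ℝ) : Prop :=
  ∀ u : Space N → ℂ, MemH10 Ω u → MemH10 Ω (phiMul φ u) →
    0 ≤ (∫ x in (Ω : Set (Space N)),
      cinner (A x *ᵥ weakGrad Ω u x) (weakGrad Ω (phiMul φ u) x)).re

open Classical in
/-- The integrand
`⟨A∇v, ∇v⟩ + Λ(|v|) ⟨(A - A*)∇|v|, |v|⁻¹ \bar v ∇v⟩ - Λ²(|v|) ⟨A∇|v|, ∇|v|⟩`,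
extended by zero on the set where `v` vanishes. -/
def formIntegrand {N : ℕ} (Ω : Opens (Space N))
    (A : Space N → Matrix (Fin N) (Fin N) ℂ) (φ : ℝ → ℝ)
    (v : Space N → ℂ) (x : Space N) : ℂ :=
  if v x = 0 then 0 else
    cinner (A x *ᵥ weakGrad Ω v x) (weakGrad Ω v x)
    + (Lambda φ ‖v x‖ : ℂ) *
        cinner ((A x - (A x)ᴴ) *ᵥ weakGrad Ω (modulus v) x)
          (((‖v x‖ : ℂ)⁻¹ * star (v x)) • weakGrad Ω v x)
    - (Lambda φ ‖v x‖ : ℂ) ^ 2 *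
        cinner (A x *ᵥ weakGrad Ω (modulus v) x) (weakGrad Ω (modulus v) x)

end FunctionalDissipativity

end

noncomputable section

namespace FunctionalDissipativity

/-! ### Dominated convergence in `L²` -/

/-! The two integrands are the same expression in different unknowns. Put `w = φ(|u|)u`, `v =
√φ(|u|) u`, and write `u`, `w`, `v` as `P(|z|)σ`, `R(|z|)σ`, `T(|z|)σ` with a common direction `σ =
z/|z|`, so that `T² = PR`. Split `σ̄∇z` into its real (radial) and imaginary (angular) parts. With
`l_f = s f'/f`, the product `⟨A∇u, ∇w⟩` is `PR/|z|²` times a combination of the four products of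
radial and angular parts, with coefficients `l_P l_R`, `1`, `l_P`, `l_R`. Since `|u| = ζ(|v|)`, the
definition of `Λ` gives `l_P = (1 + Λ(T)) l_T`, and `T² = PR` then gives `l_R = (1 - Λ(T)) l_T`. Up
to a purely imaginary quantity, the second integrand at `v` has exactly these coefficients
(`re_form_eq`, `levelCoef_comp`).

What remains is that the substitution does not automatically stay in `H̊¹`. The common variable is
`z = u + w`: then `|u|` and `|w|` are increasing functions `sumInv`, `sumInv'` of `|z|` whose
derivatives add up to 1. A radial map `f(|z|)σ` preserves `H̊¹` when `f/s` and `f'` are bounded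
(`HasH10Grad.radial`).

If the form is nonnegative, `|z|` is truncated at infinity; on a bounded range the growth condition
at 0 bounds the logarithmic derivatives, so the truncated `v` is admissible. If the operator is
dissipative, `|v|` is truncated at infinity and the corresponding `|z|` is damped near 0 so as to be
at most a multiple of `|v|`, which makes `u` and `w` admissible. In both directions the truncation
only changes the scalar coefficients of four fixed integrable functions, so it is removed by
dominated convergence (`HasH10Grad.integral_formComb_nonneg_of_tendsto`). -/

theorem memLp_two_of_dominated {α : Type*} [MeasurableSpace α] {μ : Measure α}
    {F : ℕ → α → ℂ} {f : α → ℂ} {G : α → ℝ} (hF : ∀ n, AEStronglyMeasurable (F n) μ)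
    (hG : MemLp G 2 μ) (hb : ∀ n, ∀ᵐ x ∂μ, ‖F n x‖ ≤ G x)
    (hlim : ∀ᵐ x ∂μ, Tendsto (fun n => F n x) atTop (𝓝 (f x))) : MemLp f 2 μ := by
  refine hG.of_le (aestronglyMeasurable_of_tendsto_ae atTop hF hlim) ?_
  filter_upwards [ae_all_iff.2 hb, hlim] with x hx hl
  exact (le_of_tendsto hl.norm (Eventually.of_forall hx)).trans (le_abs_self _)

theorem tendsto_eLpNorm_two_of_dominated {α : Type*} [MeasurableSpace α] {μ : Measure α}
    {F : ℕ → α → ℂ} {f : α → ℂ} {G : α → ℝ} (hF : ∀ n, AEStronglyMeasurable (F n) μ)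
    (hG : MemLp G 2 μ) (hb : ∀ n, ∀ᵐ x ∂μ, ‖F n x‖ ≤ G x)
    (hlim : ∀ᵐ x ∂μ, Tendsto (fun n => F n x) atTop (𝓝 (f x))) :
    Tendsto (fun n => eLpNorm (fun x => F n x - f x) 2 μ) atTop (𝓝 0) := by
  have hf := aestronglyMeasurable_of_tendsto_ae atTop hF hlim
  simp_rw [eLpNorm_eq_lintegral_rpow_enorm_toReal (two_ne_zero) (ENNReal.ofNat_ne_top (n := 2))]
  have h2 : (2 : ℝ≥0∞).toReal = 2 := by norm_num
  rw [h2]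
  have key : Tendsto (fun n => ∫⁻ x, ‖F n x - f x‖ₑ ^ (2 : ℝ) ∂μ) atTop (𝓝 0) := by
    have hG2 : MemLp (fun x => 2 * G x) 2 μ := hG.const_mul 2
    have := tendsto_lintegral_of_dominated_convergence' (μ := μ)
      (F := fun n x => ‖F n x - f x‖ₑ ^ (2 : ℝ)) (f := fun _ => 0)
      (fun x => ‖2 * G x‖ₑ ^ (2 : ℝ)) ?_ ?_ ?_ ?_
    · simpa using this
    · exact fun n => ((hF n).sub hf).enorm.pow_const _
    · intro n
      filter_upwards [ae_all_iff.2 hb, hlim] with x hx hl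
      have h1 : ‖f x‖ ≤ G x := le_of_tendsto hl.norm (Eventually.of_forall hx)
      refine ENNReal.rpow_le_rpow ?_ (by norm_num)
      rw [enorm_le_iff_norm_le]
      calc ‖F n x - f x‖ ≤ ‖F n x‖ + ‖f x‖ := norm_sub_le _ _
        _ ≤ 2 * G x := by linarith [hx n]
        _ ≤ ‖2 * G x‖ := le_abs_self _
    · have := lintegral_rpow_enorm_lt_top_of_eLpNorm_lt_top (two_ne_zero)
        (ENNReal.ofNat_ne_top (n := 2)) hG2.eLpNorm_lt_top
      rw [h2] at this
      exact this.ne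
    · filter_upwards [hlim] with x hl
      have h1 : Tendsto (fun n => F n x - f x) atTop (𝓝 0) := by
        simpa using hl.sub_const (f x)
      have h3 : Tendsto (fun n => ‖F n x - f x‖ₑ) atTop (𝓝 0) := by
        simpa using h1.enorm
      have := (ENNReal.continuous_rpow_const (y := 2)).continuousAt.tendsto.comp h3
      simpa [Function.comp_def] using this
  have := (ENNReal.continuous_rpow_const (y := 1 / 2)).continuousAt.tendsto.comp key
  simpa [Function.comp_def] using this

theorem exists_subseq_tendsto_ae {α : Type*} [MeasurableSpace α] {μ : Measure α}
    {F : ℕ → α → ℂ} {f : α → ℂ} (hF : ∀ n, AEStronglyMeasurable (F n) μ)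
    (hf : AEStronglyMeasurable f μ)
    (h : Tendsto (fun n => eLpNorm (fun x => F n x - f x) 2 μ) atTop (𝓝 0)) :
    ∃ ns : ℕ → ℕ, StrictMono ns ∧
      ∀ᵐ x ∂μ, Tendsto (fun k => F (ns k) x) atTop (𝓝 (f x)) :=
  (tendstoInMeasure_of_tendsto_eLpNorm two_ne_zero hF hf h).exists_seq_tendsto_ae

theorem tendsto_integral_mul_of_tendsto_eLpNorm {α : Type*} [MeasurableSpace α] {μ : Measure α}
    {F : ℕ → α → ℂ} {f ψ : α → ℂ} (hF : ∀ n, MemLp (F n) 2 μ) (hf : MemLp f 2 μ)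
    (hψ : MemLp ψ 2 μ)
    (h : Tendsto (fun n => eLpNorm (fun x => F n x - f x) 2 μ) atTop (𝓝 0)) :
    Tendsto (fun n => ∫ x, F n x * ψ x ∂μ) atTop (𝓝 (∫ x, f x * ψ x ∂μ)) := by
  refine tendsto_integral_of_L1' _ (hf.integrable_mul hψ).aestronglyMeasurable
    (Eventually.of_forall fun n => (hF n).integrable_mul hψ) ?_
  have hle : ∀ n, eLpNorm ((fun x => F n x * ψ x) - fun x => f x * ψ x) 1 μ ≤
      eLpNorm (fun x => F n x - f x) 2 μ * eLpNorm ψ 2 μ := by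
    intro n
    have := eLpNorm_smul_le_mul_eLpNorm (p := 2) (q := 2) (r := 1) (μ := μ) (f := ψ)
      hψ.aestronglyMeasurable (φ := fun x => F n x - f x)
      ((hF n).sub hf).aestronglyMeasurable
    refine le_trans (le_of_eq ?_) this
    congr 1
    ext x
    simp [sub_mul]
  have h0 : Tendsto (fun n => eLpNorm (fun x => F n x - f x) 2 μ * eLpNorm ψ 2 μ) atTop
      (𝓝 0) := by
    simpa using ENNReal.Tendsto.mul_const h (Or.inr hψ.eLpNorm_ne_top)
  exact tendsto_of_tendsto_of_tendsto_of_le_of_le tendsto_const_nhds h0 (fun _ => zero_le) hle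

/-! ### Elements of `H̊¹` together with a gradient -/

/-- Lebesgue measure on `Ω`. -/
abbrev domVol {N : ℕ} (Ω : Opens (Space N)) : Measure (Space N) :=
  volume.restrict (Ω : Set (Space N))

/-- `u` is the limit in `L²(Ω)` of test functions whose gradients converge to `g` in `L²(Ω)`. -/
def HasH10Grad {N : ℕ} (Ω : Opens (Space N)) (u : Space N → ℂ) (g : Space N → Fin N → ℂ) : Prop :=
  MemLp u 2 (domVol Ω) ∧ (∀ i, MemLp (fun x => g x i) 2 (domVol Ω)) ∧
  ∃ f : ℕ → TestFunction Ω ℂ (⊤ : ℕ∞),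
    Tendsto (fun n => eLpNorm (fun x => f n x - u x) 2 (domVol Ω)) atTop (𝓝 0) ∧
    ∀ i, Tendsto (fun n => eLpNorm (fun x => partialDeriv i (f n) x - g x i) 2 (domVol Ω))
      atTop (𝓝 0)

variable {N : ℕ} {Ω : Opens (Space N)}

theorem TestFunction.continuous_partialDeriv (f : TestFunction Ω ℂ (⊤ : ℕ∞)) (i : Fin N) :
    Continuous (partialDeriv i f) :=
  (f.contDiff.continuous_fderiv (by simp)).clm_apply continuous_const

theorem TestFunction.memLp (f : TestFunction Ω ℂ (⊤ : ℕ∞)) (μ : Measure (Space N))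
    [IsFiniteMeasureOnCompacts μ] : MemLp f 2 μ :=
  f.continuous.memLp_of_hasCompactSupport f.hasCompactSupport

theorem TestFunction.memLp_partialDeriv (f : TestFunction Ω ℂ (⊤ : ℕ∞)) (i : Fin N)
    (μ : Measure (Space N)) [IsFiniteMeasureOnCompacts μ] : MemLp (partialDeriv i f) 2 μ :=
  (TestFunction.continuous_partialDeriv f i).memLp_of_hasCompactSupport
    (f.hasCompactSupport.fderiv_apply ℝ _)

theorem TestFunction.integral_mul_partialDeriv (f ψ : TestFunction Ω ℂ (⊤ : ℕ∞)) (i : Fin N) :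
    ∫ x in (Ω : Set (Space N)), f x * partialDeriv i ψ x =
      - ∫ x in (Ω : Set (Space N)), partialDeriv i f x * ψ x := by
  have hz : ∀ x ∉ (Ω : Set (Space N)), f x = 0 := fun x hx =>
    image_eq_zero_of_notMem_tsupport fun h => hx (f.tsupport_subset h)
  have hz' : ∀ x ∉ (Ω : Set (Space N)), ψ x = 0 := fun x hx =>
    image_eq_zero_of_notMem_tsupport fun h => hx (ψ.tsupport_subset h)
  rw [setIntegral_eq_integral_of_forall_compl_eq_zero (fun x hx => by rw [hz x hx, zero_mul]),
    setIntegral_eq_integral_of_forall_compl_eq_zero (fun x hx => by rw [hz' x hx, mul_zero])]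
  exact integral_mul_fderiv_eq_neg_fderiv_mul_of_integrable
    ((TestFunction.memLp_partialDeriv f i volume).integrable_mul (TestFunction.memLp ψ volume))
    ((TestFunction.memLp f volume).integrable_mul (TestFunction.memLp_partialDeriv ψ i volume))
    ((TestFunction.memLp f volume).integrable_mul (TestFunction.memLp ψ volume))
    (fun x _ => (f.contDiff.differentiable (by simp)) x)
    (fun x _ => (ψ.contDiff.differentiable (by simp)) x)

theorem MemLp.locallyIntegrableOn_domVol {u : Space N → ℂ} (h : MemLp u 2 (domVol Ω)) :
    LocallyIntegrableOn u (Ω : Set (Space N)) volume :=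
  locallyIntegrableOn_of_locallyIntegrable_restrict (h.locallyIntegrable (by norm_num))

/-- Integration by parts holds for the approximating test functions and survives the `L²` limit, the
other factor being a fixed test function. Together with uniqueness of weak gradients, this allows
explicit gradients to be used in place of the chosen `weakGrad`. -/
theorem HasH10Grad.hasWeakGradient {u : Space N → ℂ} {g : Space N → Fin N → ℂ}
    (h : HasH10Grad Ω u g) : HasWeakGradient Ω u g := by
  obtain ⟨hu, hg, f, hf, hfg⟩ := h
  refine ⟨MemLp.locallyIntegrableOn_domVol hu, fun i =>
    ⟨MemLp.locallyIntegrableOn_domVol (hg i), fun ψ => ?_⟩⟩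
  have h1 := tendsto_integral_mul_of_tendsto_eLpNorm (fun n => TestFunction.memLp (f n) (domVol Ω))
    hu (TestFunction.memLp_partialDeriv ψ i (domVol Ω)) hf
  have h2 := (tendsto_integral_mul_of_tendsto_eLpNorm
    (fun n => TestFunction.memLp_partialDeriv (f n) i (domVol Ω))
    (hg i) (TestFunction.memLp ψ (domVol Ω)) (hfg i)).neg
  refine tendsto_nhds_unique h1 (h2.congr fun n => ?_)
  exact (TestFunction.integral_mul_partialDeriv (f n) ψ i).symm

/-- Fundamental lemma of the calculus of variations, applied to each component of the difference;
real test functions are regarded as complex valued ones. -/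
theorem HasWeakGradient.ae_eq {u : Space N → ℂ} {g g' : Space N → Fin N → ℂ}
    (h : HasWeakGradient Ω u g) (h' : HasWeakGradient Ω u g') :
    ∀ᵐ x ∂(domVol Ω), g x = g' x := by
  have key : ∀ i, ∀ᵐ x ∂(domVol Ω), g x i = g' x i := by
    intro i
    rw [ae_restrict_iff' Ω.isOpen.measurableSet]
    have := Ω.isOpen.ae_eq_zero_of_integral_contDiff_smul_eq_zero
      (μ := volume) (f := fun x => g x i - g' x i) ((h.2 i).1.sub (h'.2 i).1) ?_
    · filter_upwards [this] with x hx hxΩ using sub_eq_zero.1 (hx hxΩ)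
    intro ρ hρ hc hs
    have hs' : tsupport (fun x => (ρ x : ℂ)) ⊆ tsupport ρ :=
      closure_mono fun x hx => by simpa using hx
    let ψ : TestFunction Ω ℂ (⊤ : ℕ∞) := ⟨fun x => (ρ x : ℂ),
      Complex.ofRealCLM.contDiff.comp hρ, hc.comp_left (g := fun t : ℝ => (t : ℂ)) (by simp),
      hs'.trans hs⟩
    have e1 := (h.2 i).2 ψ
    have e2 := (h'.2 i).2 ψ
    have e3 : ∫ x in (Ω : Set (Space N)), g x i * ψ x =
        ∫ x in (Ω : Set (Space N)), g' x i * ψ x := neg_injective (e1.symm.trans e2)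
    have hint : ∀ G : Space N → ℂ, LocallyIntegrableOn G (Ω : Set (Space N)) volume →
        IntegrableOn (fun x => G x * ψ x) (Ω : Set (Space N)) := by
      intro G hG
      have hK : IntegrableOn G (tsupport ψ) :=
        hG.integrableOn_compact_subset ψ.tsupport_subset ψ.hasCompactSupport
      have h1 : IntegrableOn (fun x => G x * ψ x) (tsupport ψ) :=
        hK.mul_continuousOn ψ.continuous.continuousOn ψ.hasCompactSupport
      have h2 : Integrable (fun x => G x * ψ x) := by
        refine (integrableOn_iff_integrable_of_support_subset ?_).1 h1
        intro x hx
        refine subset_closure ?_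
        intro h0
        exact hx (by simp [h0])
      exact h2.integrableOn
    have e4 : ∫ x in (Ω : Set (Space N)), (g x i * ψ x - g' x i * ψ x) = 0 := by
      rw [integral_sub (hint _ (h.2 i).1) (hint _ (h'.2 i).1), e3, sub_self]
    rw [← setIntegral_eq_integral_of_forall_compl_eq_zero (s := (Ω : Set (Space N))), ← e4]
    · refine integral_congr_ae (Eventually.of_forall fun x => ?_)
      change (ρ x) • (g x i - g' x i) = g x i * (ρ x : ℂ) - g' x i * (ρ x : ℂ)
      rw [Complex.real_smul]
      ring
    · intro x hx
      rw [image_eq_zero_of_notMem_tsupport fun h => hx (hs h), zero_smul]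
  filter_upwards [ae_all_iff.2 key] with x hx
  exact funext hx

theorem hasWeakGradient_weakGrad {u : Space N → ℂ} (h : ∃ g, HasWeakGradient Ω u g) :
    HasWeakGradient Ω u (weakGrad Ω u) := by
  rw [weakGrad, dif_pos h]
  exact h.choose_spec

theorem HasH10Grad.weakGrad_ae_eq {u : Space N → ℂ} {g : Space N → Fin N → ℂ}
    (h : HasH10Grad Ω u g) : ∀ᵐ x ∂(domVol Ω), weakGrad Ω u x = g x :=
  (hasWeakGradient_weakGrad ⟨g, h.hasWeakGradient⟩).ae_eq h.hasWeakGradient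

theorem MemH10.hasH10Grad {u : Space N → ℂ} (h : MemH10 Ω u) : HasH10Grad Ω u (weakGrad Ω u) :=
  ⟨h.1, h.2.2.1, h.2.2.2⟩

theorem HasH10Grad.congr_grad {u : Space N → ℂ} {g g' : Space N → Fin N → ℂ}
    (h : HasH10Grad Ω u g) (hg : ∀ᵐ x ∂(domVol Ω), g x = g' x) : HasH10Grad Ω u g' := by
  obtain ⟨hu, hgm, f, hf, hfg⟩ := h
  have hi : ∀ i, (fun x => g x i) =ᵐ[domVol Ω] fun x => g' x i := fun i => by
    filter_upwards [hg] with x hx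
    rw [hx]
  refine ⟨hu, fun i => (memLp_congr_ae (hi i)).1 (hgm i), f, hf, fun i => ?_⟩
  refine (hfg i).congr fun n => eLpNorm_congr_ae ?_
  filter_upwards [hi i] with x hx
  rw [hx]

theorem HasH10Grad.memH10 {u : Space N → ℂ} {g : Space N → Fin N → ℂ}
    (h : HasH10Grad Ω u g) : MemH10 Ω u := by
  have h' := h.congr_grad (h.weakGrad_ae_eq.mono fun x hx => hx.symm)
  exact ⟨h.1, ⟨g, h.hasWeakGradient⟩, h'.2.1, h'.2.2⟩

theorem TestFunction.hasH10Grad (f : TestFunction Ω ℂ (⊤ : ℕ∞)) :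
    HasH10Grad Ω f (fun x i => partialDeriv i f x) :=
  ⟨TestFunction.memLp f _, fun i => TestFunction.memLp_partialDeriv f i _, fun _ => f, by simp,
    fun i => by simp⟩

theorem HasH10Grad.add {u u' : Space N → ℂ} {g g' : Space N → Fin N → ℂ}
    (h : HasH10Grad Ω u g) (h' : HasH10Grad Ω u' g') :
    HasH10Grad Ω (fun x => u x + u' x) (fun x i => g x i + g' x i) := by
  obtain ⟨hu, hg, f, hf, hfg⟩ := h
  obtain ⟨hu', hg', f', hf', hfg'⟩ := h'
  have hadd : ∀ a b : Space N → ℂ, MemLp a 2 (domVol Ω) → MemLp b 2 (domVol Ω) →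
      eLpNorm (fun x => a x + b x) 2 (domVol Ω) ≤
        eLpNorm a 2 (domVol Ω) + eLpNorm b 2 (domVol Ω) := fun a b ha hb =>
    eLpNorm_add_le ha.aestronglyMeasurable hb.aestronglyMeasurable (by norm_num)
  refine ⟨hu.add hu', fun i => (hg i).add (hg' i), fun n => f n + f' n, ?_, fun i => ?_⟩
  · have h0 := hf.add hf'
    rw [add_zero] at h0
    refine tendsto_of_tendsto_of_tendsto_of_le_of_le tendsto_const_nhds h0
      (fun _ => zero_le) fun n => ?_
    refine le_trans (le_of_eq ?_) (hadd _ _ ((TestFunction.memLp (f n) _).sub hu)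
      ((TestFunction.memLp (f' n) _).sub hu'))
    congr 1
    ext x
    change f n x + f' n x - (u x + u' x) = f n x - u x + (f' n x - u' x)
    ring
  · have h0 := (hfg i).add (hfg' i)
    rw [add_zero] at h0
    refine tendsto_of_tendsto_of_tendsto_of_le_of_le tendsto_const_nhds h0
      (fun _ => zero_le) fun n => ?_
    refine le_trans (le_of_eq ?_) (hadd _ _ ((TestFunction.memLp_partialDeriv (f n) i _).sub (hg i))
      ((TestFunction.memLp_partialDeriv (f' n) i _).sub (hg' i)))
    congr 1
    ext x
    have hd : partialDeriv i (f n + f' n : TestFunction Ω ℂ (⊤ : ℕ∞)) x =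
        partialDeriv i (f n) x + partialDeriv i (f' n) x := by
      have : ((f n + f' n : TestFunction Ω ℂ (⊤ : ℕ∞)) : Space N → ℂ) = ⇑(f n) + ⇑(f' n) := by
        ext; simp
      rw [partialDeriv, this, fderiv_add ((f n).contDiff.differentiable (by simp) x)
        ((f' n).contDiff.differentiable (by simp) x)]
      rfl
    rw [hd]
    ring

/-- Diagonal argument: the `n`-th element is replaced by a test function within `1/(n+1)` of it, in
value and in gradient. -/
theorem HasH10Grad.of_tendsto {un : ℕ → Space N → ℂ} {gn : ℕ → Space N → Fin N → ℂ}
    {u : Space N → ℂ} {g : Space N → Fin N → ℂ} (h : ∀ n, HasH10Grad Ω (un n) (gn n))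
    (hu : MemLp u 2 (domVol Ω)) (hg : ∀ i, MemLp (fun x => g x i) 2 (domVol Ω))
    (hlim : Tendsto (fun n => eLpNorm (fun x => un n x - u x) 2 (domVol Ω)) atTop (𝓝 0))
    (hlim' : ∀ i, Tendsto (fun n => eLpNorm (fun x => gn n x i - g x i) 2 (domVol Ω))
      atTop (𝓝 0)) : HasH10Grad Ω u g := by
  have hex : ∀ n : ℕ, ∃ f : TestFunction Ω ℂ (⊤ : ℕ∞),
      eLpNorm (fun x => f x - un n x) 2 (domVol Ω) ≤ ((n : ℝ≥0∞) + 1)⁻¹ ∧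
      ∀ i, eLpNorm (fun x => partialDeriv i f x - gn n x i) 2 (domVol Ω) ≤
        ((n : ℝ≥0∞) + 1)⁻¹ := by
    intro n
    obtain ⟨-, -, f, hf, hfg⟩ := h n
    have hpos : (0 : ℝ≥0∞) < ((n : ℝ≥0∞) + 1)⁻¹ :=
      ENNReal.inv_pos.2 (by simp)
    have e1 := hf.eventually_le_const hpos
    have e2 := eventually_all.2 fun i => (hfg i).eventually_le_const hpos
    obtain ⟨k, hk1, hk2⟩ := (e1.and e2).exists
    exact ⟨f k, hk1, hk2⟩
  choose f hf hfg using hex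
  have hinv : Tendsto (fun n : ℕ => ((n : ℝ≥0∞) + 1)⁻¹) atTop (𝓝 0) := by
    have := ENNReal.tendsto_inv_nat_nhds_zero.comp (tendsto_add_atTop_nat 1)
    simpa [Function.comp_def] using this
  have tri : ∀ a b c : Space N → ℂ, MemLp a 2 (domVol Ω) → MemLp b 2 (domVol Ω) →
      MemLp c 2 (domVol Ω) → eLpNorm (fun x => a x - c x) 2 (domVol Ω) ≤
        eLpNorm (fun x => a x - b x) 2 (domVol Ω) +
          eLpNorm (fun x => b x - c x) 2 (domVol Ω) := by
    intro a b c ha hb hc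
    refine le_trans (le_of_eq ?_) (eLpNorm_add_le (ha.sub hb).aestronglyMeasurable
      (hb.sub hc).aestronglyMeasurable (by norm_num))
    congr 1
    ext x
    simp
  refine ⟨hu, hg, f, ?_, fun i => ?_⟩
  · have h0 := hinv.add hlim
    rw [add_zero] at h0
    exact tendsto_of_tendsto_of_tendsto_of_le_of_le tendsto_const_nhds h0 (fun _ => zero_le)
      fun n => (tri _ _ _ (TestFunction.memLp (f n) _) (h n).1 hu).trans
        (add_le_add (hf n) le_rfl)
  · have h0 := hinv.add (hlim' i)
    rw [add_zero] at h0
    exact tendsto_of_tendsto_of_tendsto_of_le_of_le tendsto_const_nhds h0 (fun _ => zero_le)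
      fun n => (tri _ _ _ (TestFunction.memLp_partialDeriv (f n) i _) ((h n).2.1 i) (hg i)).trans
        (add_le_add (hfg n i) le_rfl)

theorem HasH10Grad.of_dominated {un : ℕ → Space N → ℂ} {gn : ℕ → Space N → Fin N → ℂ}
    {u : Space N → ℂ} {g : Space N → Fin N → ℂ} {G : Space N → ℝ} {G' : Space N → Fin N → ℝ}
    (h : ∀ n, HasH10Grad Ω (un n) (gn n))
    (hG : MemLp G 2 (domVol Ω)) (hG' : ∀ i, MemLp (fun x => G' x i) 2 (domVol Ω))
    (hb : ∀ n, ∀ᵐ x ∂(domVol Ω), ‖un n x‖ ≤ G x)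
    (hb' : ∀ n i, ∀ᵐ x ∂(domVol Ω), ‖gn n x i‖ ≤ G' x i)
    (hlim : ∀ᵐ x ∂(domVol Ω), Tendsto (fun n => un n x) atTop (𝓝 (u x)))
    (hlim' : ∀ i, ∀ᵐ x ∂(domVol Ω), Tendsto (fun n => gn n x i) atTop (𝓝 (g x i))) :
    HasH10Grad Ω u g :=
  HasH10Grad.of_tendsto h
    (memLp_two_of_dominated (fun n => (h n).1.aestronglyMeasurable) hG hb hlim)
    (fun i => memLp_two_of_dominated (fun n => ((h n).2.1 i).aestronglyMeasurable) (hG' i)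
      (fun n => hb' n i) (hlim' i))
    (tendsto_eLpNorm_two_of_dominated (fun n => (h n).1.aestronglyMeasurable) hG hb hlim)
    (fun i => tendsto_eLpNorm_two_of_dominated (fun n => ((h n).2.1 i).aestronglyMeasurable)
      (hG' i) (fun n => hb' n i) (hlim' i))

/-! ### Chain rule in `H̊¹` -/

theorem norm_sub_le_of_norm_fderiv_le {F : ℂ → ℂ} {K : ℝ} (hF : Differentiable ℝ F)
    (hK : ∀ z, ‖fderiv ℝ F z‖ ≤ K) (z w : ℂ) : ‖F z - F w‖ ≤ K * ‖z - w‖ :=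
  convex_univ.norm_image_sub_le_of_norm_fderiv_le (fun x _ => hF x) (fun x _ => hK x)
    (mem_univ w) (mem_univ z)

theorem continuous_uncurry_fderiv {F : ℂ → ℂ} (hF : ContDiff ℝ 1 F) :
    Continuous (Function.uncurry fun z w : ℂ => fderiv ℝ F z w) :=
  ((hF.continuous_fderiv one_ne_zero).comp continuous_fst).clm_apply continuous_snd

/-- The composition of a test function with a smooth map fixing `0`. -/
def TestFunction.compLeft (F : ℂ → ℂ) (hF : ContDiff ℝ (⊤ : ℕ∞) F) (h0 : F 0 = 0)
    (f : TestFunction Ω ℂ (⊤ : ℕ∞)) : TestFunction Ω ℂ (⊤ : ℕ∞) :=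
  ⟨F ∘ f, hF.comp f.contDiff, f.hasCompactSupport.comp_left h0,
    (tsupport_comp_subset h0 f).trans f.tsupport_subset⟩

theorem partialDeriv_comp {F : ℂ → ℂ} (hF : Differentiable ℝ F) {f : Space N → ℂ}
    (hf : Differentiable ℝ f) (i : Fin N) (x : Space N) :
    partialDeriv i (F ∘ f) x = fderiv ℝ F (f x) (partialDeriv i f x) := by
  rw [partialDeriv, fderiv_comp x (hF _) (hf _)]
  rfl

/-- For approximating test functions `f_k` the error in the gradient is `F'(f_k)(∂f_k - g) +
(F'(f_k) - F'(v)) g`. The first term is controlled by the bound on `F'`, the second by dominated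
convergence along a subsequence converging almost everywhere. -/
theorem HasH10Grad.comp_smooth {v : Space N → ℂ} {g : Space N → Fin N → ℂ}
    (h : HasH10Grad Ω v g) {F : ℂ → ℂ} (hF : ContDiff ℝ (⊤ : ℕ∞) F) (h0 : F 0 = 0) {K : ℝ}
    (hK : ∀ z, ‖fderiv ℝ F z‖ ≤ K) :
    HasH10Grad Ω (fun x => F (v x)) (fun x i => fderiv ℝ F (v x) (g x i)) := by
  have hd : Differentiable ℝ F := hF.differentiable (by simp)
  have hF1 : ContDiff ℝ 1 F := hF.of_le (by simp)
  have hK0 : 0 ≤ K := (norm_nonneg _).trans (hK 0)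
  have hv := h.1
  have hg := h.2.1
  obtain ⟨-, -, f, hf, hfg⟩ := h
  obtain ⟨ns, hns, hae⟩ := exists_subseq_tendsto_ae
    (fun n => (TestFunction.memLp (f n) (domVol Ω)).aestronglyMeasurable)
    hv.aestronglyMeasurable hf
  have hlip := norm_sub_le_of_norm_fderiv_le hd hK
  have hcont := continuous_uncurry_fderiv hF1
  have hmeas : ∀ a b : Space N → ℂ, MemLp a 2 (domVol Ω) → MemLp b 2 (domVol Ω) →
      AEStronglyMeasurable (fun x => fderiv ℝ F (a x) (b x)) (domVol Ω) := fun a b ha hb =>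
    hcont.comp_aestronglyMeasurable₂ ha.aestronglyMeasurable hb.aestronglyMeasurable
  have hmem : ∀ a b : Space N → ℂ, MemLp a 2 (domVol Ω) → MemLp b 2 (domVol Ω) →
      MemLp (fun x => fderiv ℝ F (a x) (b x)) 2 (domVol Ω) := fun a b ha hb =>
    hb.of_le_mul (c := K) (hmeas a b ha hb) (Eventually.of_forall fun x =>
      ContinuousLinearMap.le_of_opNorm_le _ (hK _) _)
  have hbd : ∀ (a b : Space N → ℂ), (∀ x, ‖a x‖ ≤ K * ‖b x‖) →
      eLpNorm a 2 (domVol Ω) ≤ K.toNNReal • eLpNorm b 2 (domVol Ω) := by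
    intro a b hab
    refine eLpNorm_le_nnreal_smul_eLpNorm_of_ae_le_mul (Eventually.of_forall fun x => ?_) 2
    rw [← NNReal.coe_le_coe]
    simpa [Real.coe_toNNReal K hK0] using hab x
  have hsm : ∀ (a : ℕ → ℝ≥0∞), Tendsto a atTop (𝓝 0) →
      Tendsto (fun n => K.toNNReal • a n) atTop (𝓝 0) := by
    intro a ha
    simpa [ENNReal.smul_def] using
      ENNReal.Tendsto.const_mul (a := (K.toNNReal : ℝ≥0∞)) ha (Or.inr ENNReal.coe_ne_top)
  refine HasH10Grad.of_tendsto
    (fun k => TestFunction.hasH10Grad (TestFunction.compLeft F hF h0 (f (ns k))))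
    ?_ (fun i => hmem _ _ hv (hg i)) ?_ fun i => ?_
  · refine hv.of_le_mul (c := K) (hF.continuous.comp_aestronglyMeasurable
      hv.aestronglyMeasurable) (Eventually.of_forall fun x => ?_)
    simpa [h0] using hlip (v x) 0
  · exact tendsto_of_tendsto_of_tendsto_of_le_of_le tendsto_const_nhds
      (hsm _ (hf.comp hns.tendsto_atTop)) (fun _ => zero_le) fun k =>
      hbd _ _ fun x => hlip _ _
  · have e : ∀ k x, partialDeriv i (TestFunction.compLeft F hF h0 (f (ns k))) x =
        fderiv ℝ F (f (ns k) x) (partialDeriv i (f (ns k)) x) := fun k x =>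
      partialDeriv_comp hd ((f (ns k)).contDiff.differentiable (by simp)) i x
    simp_rw [e]
    have t1 := hsm _ ((hfg i).comp hns.tendsto_atTop)
    have t2 : Tendsto (fun k => eLpNorm (fun x => fderiv ℝ F (f (ns k) x) (g x i) -
        fderiv ℝ F (v x) (g x i)) 2 (domVol Ω)) atTop (𝓝 0) := by
      refine tendsto_eLpNorm_two_of_dominated (G := fun x => K * ‖g x i‖)
        (fun k => hmeas _ _ (TestFunction.memLp _ _) (hg i)) ((hg i).norm.const_mul K)
        (fun k => Eventually.of_forall fun x => ContinuousLinearMap.le_of_opNorm_le _ (hK _) _) ?_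
      filter_upwards [hae] with x hx
      exact ((hcont.comp (continuous_id.prodMk continuous_const)).tendsto (v x)).comp hx
    have t3 := t1.add t2
    rw [add_zero] at t3
    refine tendsto_of_tendsto_of_tendsto_of_le_of_le tendsto_const_nhds t3
      (fun _ => zero_le) fun k => ?_
    have m1 := TestFunction.memLp (f (ns k)) (domVol Ω)
    have m2 := TestFunction.memLp_partialDeriv (f (ns k)) i (domVol Ω)
    refine le_trans (le_trans (le_of_eq ?_) (eLpNorm_add_le
      (f := fun x => fderiv ℝ F (f (ns k) x) (partialDeriv i (f (ns k)) x - g x i))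
      (g := fun x => fderiv ℝ F (f (ns k) x) (g x i) - fderiv ℝ F (v x) (g x i))
      (hmeas _ _ m1 (m2.sub (hg i)))
      ((hmeas _ _ m1 (hg i)).sub (hmeas _ _ hv (hg i))) (by norm_num))) (add_le_add
      (hbd _ _ fun x => ContinuousLinearMap.le_of_opNorm_le _ (hK _) _) le_rfl)
    congr 1
    ext x
    simp

/-- Mollification: averaging preserves the bound on the derivative. The value at 0 is subtracted
because composition keeps compact support only if 0 is fixed. -/
theorem exists_contDiff_approx {F : ℂ → ℂ} (hF : ContDiff ℝ 1 F) (h0 : F 0 = 0) {K : ℝ}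
    (hK : ∀ z, ‖fderiv ℝ F z‖ ≤ K) :
    ∃ Fk : ℕ → ℂ → ℂ, (∀ k, ContDiff ℝ (⊤ : ℕ∞) (Fk k)) ∧ (∀ k, Fk k 0 = 0) ∧
      (∀ k z, ‖fderiv ℝ (Fk k) z‖ ≤ K) ∧ (∀ z, Tendsto (fun k => Fk k z) atTop (𝓝 (F z))) ∧
      ∀ z, Tendsto (fun k => fderiv ℝ (Fk k) z) atTop (𝓝 (fderiv ℝ F z)) := by
  have hd : Differentiable ℝ F := hF.differentiable one_ne_zero
  have hcd : Continuous (fderiv ℝ F) := hF.continuous_fderiv one_ne_zero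
  let ρ : ℕ → ContDiffBump (0 : ℂ) := fun k =>
    ⟨1 / (2 * ((k : ℝ) + 1)), 1 / ((k : ℝ) + 1), by positivity, by
      have : (0 : ℝ) < (k : ℝ) + 1 := by positivity
      exact one_div_lt_one_div_of_lt this (by linarith)⟩
  have hρ : Tendsto (fun k => (ρ k).rOut) atTop (𝓝 0) := tendsto_one_div_add_atTop_nhds_zero_nat
  let C : ℕ → ℂ → ℂ := fun k =>
    convolution ((ρ k).normed volume) F (ContinuousLinearMap.lsmul ℝ ℝ) volume
  have hC : ∀ k, ContDiff ℝ (⊤ : ℕ∞) (C k) := fun k =>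
    (ρ k).hasCompactSupport_normed.contDiff_convolution_left _ (ρ k).contDiff_normed
      hF.continuous.locallyIntegrable
  have hsmulc : ∀ k, Continuous ((ρ k).normed volume) := fun k => (ρ k).continuous_normed
  have hder : ∀ k z, HasFDerivAt (C k)
      (convolution ((ρ k).normed volume) (fderiv ℝ F) (ContinuousLinearMap.lsmul ℝ ℝ) volume z)
      z := by
    intro k z
    refine hasFDerivAt_integral_of_dominated_of_fderiv_le (𝕜 := ℝ) (s := univ)
      (F := fun x t => (ρ k).normed volume t • F (x - t))
      (F' := fun x t => (ρ k).normed volume t • fderiv ℝ F (x - t))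
      (bound := fun t => (ρ k).normed volume t * K) univ_mem ?_ ?_ ?_ ?_ ?_ ?_
    · refine Eventually.of_forall fun x => Continuous.aestronglyMeasurable ?_
      exact (hsmulc k).smul (hF.continuous.comp (continuous_const.sub continuous_id))
    · refine Continuous.integrable_of_hasCompactSupport
        ((hsmulc k).smul (hF.continuous.comp (continuous_const.sub continuous_id))) ?_
      exact (ρ k).hasCompactSupport_normed.smul_right
    · exact Continuous.aestronglyMeasurable
        ((hsmulc k).smul (hcd.comp (continuous_const.sub continuous_id)))
    · refine Eventually.of_forall fun t x _ => ?_
      rw [norm_smul, Real.norm_of_nonneg ((ρ k).nonneg_normed t)]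
      exact mul_le_mul_of_nonneg_left (hK _) ((ρ k).nonneg_normed t)
    · exact (ρ k).integrable_normed.mul_const K
    · refine Eventually.of_forall fun t x _ => ?_
      have := (hd (x - t)).hasFDerivAt.comp x ((hasFDerivAt_id x).sub_const t)
      exact (this.const_smul ((ρ k).normed volume t)).congr_fderiv (by ext w; simp)
  refine ⟨fun k z => C k z - C k 0, fun k => (hC k).sub contDiff_const, fun k => sub_self _,
    fun k z => ?_, fun z => ?_, fun z => ?_⟩
  · rw [((hder k z).sub_const (C k 0)).fderiv]
    calc _ ≤ ∫ t, (ρ k).normed volume t * K := by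
          refine norm_integral_le_of_norm_le ((ρ k).integrable_normed.mul_const K)
            (Eventually.of_forall fun t => ?_)
          change ‖(ρ k).normed volume t • fderiv ℝ F (z - t)‖ ≤ _
          rw [norm_smul, Real.norm_of_nonneg ((ρ k).nonneg_normed t)]
          exact mul_le_mul_of_nonneg_left (hK _) ((ρ k).nonneg_normed t)
      _ = K := by rw [integral_mul_const, (ρ k).integral_normed, one_mul]
  · have := (ContDiffBump.convolution_tendsto_right_of_continuous (μ := volume) hρ
      hF.continuous z).sub (ContDiffBump.convolution_tendsto_right_of_continuous (μ := volume) hρ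
      hF.continuous 0)
    rwa [h0, sub_zero] at this
  · refine (ContDiffBump.convolution_tendsto_right_of_continuous (μ := volume) hρ hcd z).congr
      fun k => ?_
    exact ((hder k z).sub_const (C k 0)).fderiv.symm

theorem HasH10Grad.comp {v : Space N → ℂ} {g : Space N → Fin N → ℂ}
    (h : HasH10Grad Ω v g) {F : ℂ → ℂ} (hF : ContDiff ℝ 1 F) (h0 : F 0 = 0) {K : ℝ}
    (hK : ∀ z, ‖fderiv ℝ F z‖ ≤ K) :
    HasH10Grad Ω (fun x => F (v x)) (fun x i => fderiv ℝ F (v x) (g x i)) := by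
  obtain ⟨Fk, hsm, hz, hb, hl, hl'⟩ := exists_contDiff_approx hF h0 hK
  refine HasH10Grad.of_dominated (G := fun x => K * ‖v x‖) (G' := fun x i => K * ‖g x i‖)
    (fun k => h.comp_smooth (hsm k) (hz k) (hb k)) (h.1.norm.const_mul K)
    (fun i => (h.2.1 i).norm.const_mul K)
    (fun k => Eventually.of_forall fun x => ?_)
    (fun k i => Eventually.of_forall fun x => ContinuousLinearMap.le_of_opNorm_le _ (hb k _) _)
    (Eventually.of_forall fun x => hl _)
    (fun i => Eventually.of_forall fun x => ?_)
  · simpa [hz k] using norm_sub_le_of_norm_fderiv_le ((hsm k).differentiable (by simp))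
      (hb k) (v x) 0
  · exact ((ContinuousLinearMap.apply ℝ ℂ (g x i)).continuous.tendsto _).comp (hl' (v x))

/-! ### Radial maps of the complex plane -/

/-- The direction `z / |z|` (zero at the origin). -/
def unitDir (z : ℂ) : ℂ := z / (‖z‖ : ℂ)

/-- The component of `w` along `z`. -/
def radPart (z w : ℂ) : ℝ := (star (unitDir z) * w).re

/-- The component of `w` orthogonal to `z`. -/
def angPart (z w : ℂ) : ℝ := (star (unitDir z) * w).im

@[simp] theorem unitDir_zero : unitDir 0 = 0 := by simp [unitDir]

@[simp] theorem radPart_zero (w : ℂ) : radPart 0 w = 0 := by simp [radPart]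

@[simp] theorem angPart_zero (w : ℂ) : angPart 0 w = 0 := by simp [angPart]

theorem norm_unitDir {z : ℂ} (hz : z ≠ 0) : ‖unitDir z‖ = 1 := by
  simp [unitDir, hz]

theorem norm_unitDir_le (z : ℂ) : ‖unitDir z‖ ≤ 1 := by
  by_cases hz : z = 0
  · simp [hz]
  · exact (norm_unitDir hz).le

theorem star_unitDir_mul {z : ℂ} (hz : z ≠ 0) : star (unitDir z) * unitDir z = 1 := by
  have := Complex.normSq_eq_conj_mul_self (z := unitDir z)
  rw [Complex.normSq_eq_norm_sq, norm_unitDir hz] at this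
  simpa using this.symm

theorem unitDir_mul_star {z : ℂ} (hz : z ≠ 0) : unitDir z * star (unitDir z) = 1 := by
  rw [mul_comm, star_unitDir_mul hz]

theorem norm_mul_unitDir (z : ℂ) : (‖z‖ : ℂ) * unitDir z = z := by
  by_cases hz : z = 0
  · simp [hz]
  · have : (‖z‖ : ℂ) ≠ 0 := by simpa using hz
    rw [unitDir]
    field_simp

theorem star_unitDir_mul_eq (z w : ℂ) :
    star (unitDir z) * w = (radPart z w : ℂ) + Complex.I * (angPart z w : ℂ) := by
  rw [mul_comm Complex.I]
  exact (Complex.re_add_im _).symm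

theorem eq_unitDir_mul {z : ℂ} (hz : z ≠ 0) (w : ℂ) :
    w = unitDir z * ((radPart z w : ℂ) + Complex.I * (angPart z w : ℂ)) := by
  rw [← star_unitDir_mul_eq, ← mul_assoc, unitDir_mul_star hz, one_mul]

theorem norm_star_unitDir_mul_le (z w : ℂ) : ‖star (unitDir z) * w‖ ≤ ‖w‖ := by
  rw [norm_mul, norm_star]
  exact mul_le_of_le_one_left (norm_nonneg _) (norm_unitDir_le z)

theorem abs_radPart_le (z w : ℂ) : |radPart z w| ≤ ‖w‖ :=
  (Complex.abs_re_le_norm _).trans (norm_star_unitDir_mul_le z w)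

theorem abs_angPart_le (z w : ℂ) : |angPart z w| ≤ ‖w‖ :=
  (Complex.abs_im_le_norm _).trans (norm_star_unitDir_mul_le z w)

theorem norm_radial_combination_le (z w : ℂ) {c d K : ℝ} (hc : |c| ≤ K) (hd : |d| ≤ K) :
    ‖unitDir z * ((c : ℂ) * radPart z w + (d : ℂ) * (Complex.I * angPart z w))‖ ≤ K * ‖w‖ := by
  have hK : 0 ≤ K := (abs_nonneg c).trans hc
  have h1 : ‖(c : ℂ) * radPart z w + (d : ℂ) * (Complex.I * angPart z w)‖ ≤ K * ‖w‖ := by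
    have e : (c : ℂ) * radPart z w + (d : ℂ) * (Complex.I * angPart z w) =
        ((c * radPart z w : ℝ) : ℂ) + ((d * angPart z w : ℝ) : ℂ) * Complex.I := by
      push_cast
      ring
    have h2 : ‖star (unitDir z) * w‖ ^ 2 ≤ ‖w‖ ^ 2 :=
      pow_le_pow_left₀ (norm_nonneg _) (norm_star_unitDir_mul_le z w) 2
    rw [← Complex.normSq_eq_norm_sq, Complex.normSq_apply] at h2
    change radPart z w * radPart z w + angPart z w * angPart z w ≤ _ at h2
    refine abs_le_of_sq_le_sq' ?_ (by positivity) |>.2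
    rw [e, ← Complex.normSq_eq_norm_sq, Complex.normSq_add_mul_I, mul_pow, mul_pow, mul_pow]
    have hc2 : c ^ 2 ≤ K ^ 2 := sq_le_sq' (by linarith [abs_le.1 hc]) (abs_le.1 hc).2
    have hd2 : d ^ 2 ≤ K ^ 2 := sq_le_sq' (by linarith [abs_le.1 hd]) (abs_le.1 hd).2
    nlinarith [mul_le_mul_of_nonneg_right hc2 (sq_nonneg (radPart z w)),
      mul_le_mul_of_nonneg_right hd2 (sq_nonneg (angPart z w)), sq_nonneg K,
      mul_le_mul_of_nonneg_left h2 (sq_nonneg K)]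
  rw [norm_mul]
  exact (mul_le_of_le_one_left (norm_nonneg _) (norm_unitDir_le z)).trans h1

theorem hasFDerivAt_norm_complex {z : ℂ} (hz : z ≠ 0) :
    HasFDerivAt (fun w : ℂ => ‖w‖) ((1 / ‖z‖) • innerSL ℝ z) z := by
  have h := (hasStrictFDerivAt_norm_sq z).hasFDerivAt.sqrt (by simpa using hz)
  simp only [Real.sqrt_sq (norm_nonneg _)] at h
  refine h.congr_fderiv ?_
  ext w
  all_goals
    simp
    field_simp

theorem inner_eq_norm_mul_radPart (z w : ℂ) : inner ℝ z w = ‖z‖ * radPart z w := by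
  rw [Complex.inner, radPart]
  conv_lhs => rw [← norm_mul_unitDir z]
  rw [map_mul, Complex.conj_ofReal, mul_left_comm, Complex.re_ofReal_mul, mul_comm w]
  rfl

/-- `f` is positive and differentiable on `(0, ∞)` with continuous logarithmic derivative
`s f'(s) / f(s) = l(s)`. -/
structure IsProfile (f l : ℝ → ℝ) : Prop where
  pos : ∀ s, 0 < s → 0 < f s
  hasDerivAt : ∀ s, 0 < s → HasDerivAt f (l s * f s / s) s
  continuousOn : ContinuousOn l (Ioi 0)

theorem IsProfile.continuousOn_left {f l : ℝ → ℝ} (h : IsProfile f l) : ContinuousOn f (Ioi 0) :=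
  fun s hs => (h.hasDerivAt s hs).continuousAt.continuousWithinAt

theorem IsProfile.continuousAt_left {f l : ℝ → ℝ} (h : IsProfile f l) {s : ℝ} (hs : 0 < s) :
    ContinuousAt f s := (h.hasDerivAt s hs).continuousAt

theorem IsProfile.continuousAt {f l : ℝ → ℝ} (h : IsProfile f l) {s : ℝ} (hs : 0 < s) :
    ContinuousAt l s := h.continuousOn.continuousAt (Ioi_mem_nhds hs)

/-- The radial map `z ↦ f(|z|) z / |z|`. -/
def radialMap (f : ℝ → ℝ) (z : ℂ) : ℂ := ((f ‖z‖ / ‖z‖ : ℝ) : ℂ) * z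

/-- The derivative of `radialMap f` at `z` in the direction `w`, if `f` has logarithmic
derivative `l`. -/
def radialGrad (f l : ℝ → ℝ) (z w : ℂ) : ℂ :=
  unitDir z * (((l ‖z‖ * (f ‖z‖ / ‖z‖) : ℝ) : ℂ) * radPart z w +
    ((f ‖z‖ / ‖z‖ : ℝ) : ℂ) * (Complex.I * angPart z w))

@[simp] theorem radialMap_zero (f : ℝ → ℝ) : radialMap f 0 = 0 := by simp [radialMap]

@[simp] theorem radialGrad_zero (f l : ℝ → ℝ) (w : ℂ) : radialGrad f l 0 w = 0 := by
  simp [radialGrad]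

theorem radialMap_eq (f : ℝ → ℝ) (z : ℂ) :
    radialMap f z = (f ‖z‖ : ℂ) * unitDir z := by
  rw [radialMap, unitDir]
  push_cast
  ring

theorem norm_radialMap {f l : ℝ → ℝ} (h : IsProfile f l) {z : ℂ} (hz : z ≠ 0) :
    ‖radialMap f z‖ = f ‖z‖ := by
  rw [radialMap_eq f z, norm_mul, norm_unitDir hz, mul_one, Complex.norm_real,
    Real.norm_of_nonneg (h.pos _ (norm_pos_iff.2 hz)).le]

theorem IsProfile.hasFDerivAt_radialMap {f l : ℝ → ℝ} (h : IsProfile f l) {z : ℂ} (hz : z ≠ 0) :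
    ∃ L : ℂ →L[ℝ] ℂ, HasFDerivAt (radialMap f) L z ∧ ∀ w, L w = radialGrad f l z w := by
  have hs : 0 < ‖z‖ := norm_pos_iff.2 hz
  have h1 : HasDerivAt (fun s => f s / s) ((l ‖z‖ * f ‖z‖ / ‖z‖ * ‖z‖ - f ‖z‖ * 1) / ‖z‖ ^ 2) ‖z‖ :=
    (h.hasDerivAt _ hs).div (hasDerivAt_id _) hs.ne'
  have h2 := h1.comp_hasFDerivAt z (hasFDerivAt_norm_complex hz)
  have h3 := h2.smul (hasFDerivAt_id (𝕜 := ℝ) z)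
  refine ⟨_, h3.congr_of_eventuallyEq (Eventually.of_forall fun w => ?_), fun w => ?_⟩
  · simp [radialMap]
  · simp only [_root_.add_apply, _root_.smul_apply,
      ContinuousLinearMap.smulRight_apply, ContinuousLinearMap.id_apply, innerSL_apply_apply,
      Function.comp_apply, id, inner_eq_norm_mul_radPart, radialGrad, Complex.real_smul, smul_eq_mul]
    conv_lhs =>
      enter [2, 2]
      rw [← norm_mul_unitDir z]
    have : (‖z‖ : ℂ) ≠ 0 := by simpa using hz
    push_cast
    field_simp
    linear_combination (f ‖z‖ : ℂ) * eq_unitDir_mul hz w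

theorem norm_radialGrad_le {f l : ℝ → ℝ} {K : ℝ} {z : ℂ} (w : ℂ) (h1 : |f ‖z‖ / ‖z‖| ≤ K)
    (h2 : |l ‖z‖ * (f ‖z‖ / ‖z‖)| ≤ K) : ‖radialGrad f l z w‖ ≤ K * ‖w‖ :=
  norm_radial_combination_le z w h2 h1

theorem continuousAt_unitDir {z : ℂ} (hz : z ≠ 0) : ContinuousAt unitDir z :=
  continuousAt_id.div (Complex.continuous_ofReal.comp continuous_norm).continuousAt (by simpa using hz)

/-- The quadratic bound on `f` makes the derivative at the origin exist and vanish, and the linear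
bound on the gradient away from 0 makes it continuous there. -/
theorem IsProfile.contDiff_radialMap {f l : ℝ → ℝ} (h : IsProfile f l) {C : ℝ}
    (h1 : ∀ s, 0 < s → |f s / s| ≤ C * s) (h2 : ∀ s, 0 < s → |l s * (f s / s)| ≤ C * s) :
    ContDiff ℝ 1 (radialMap f) ∧ ∀ z w, fderiv ℝ (radialMap f) z w = radialGrad f l z w := by
  have hzero : HasFDerivAt (radialMap f) (0 : ℂ →L[ℝ] ℂ) 0 := by
    refine Asymptotics.IsBigO.hasFDerivAt (n := 2) ?_ one_lt_two
    refine Asymptotics.IsBigO.of_bound C (Eventually.of_forall fun z => ?_)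
    by_cases hz : z = 0
    · simp [hz]
    · have := h1 ‖z‖ (norm_pos_iff.2 hz)
      rw [radialMap, norm_mul, Complex.norm_real, Real.norm_eq_abs]
      simp only [sub_zero, norm_pow, norm_norm]
      nlinarith [norm_nonneg z]
  have hfd : ∀ z w, fderiv ℝ (radialMap f) z w = radialGrad f l z w := by
    intro z w
    by_cases hz : z = 0
    · simp [hz, hzero.fderiv]
    · obtain ⟨L, hL, hLw⟩ := h.hasFDerivAt_radialMap hz
      rw [hL.fderiv, hLw]
  refine ⟨contDiff_one_iff_fderiv.2 ⟨fun z => ?_, ?_⟩, hfd⟩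
  · by_cases hz : z = 0
    · exact hz ▸ hzero.differentiableAt
    · obtain ⟨L, hL, -⟩ := h.hasFDerivAt_radialMap hz
      exact hL.differentiableAt
  · refine continuous_clm_apply.2 fun w => ?_
    simp_rw [hfd]
    refine continuous_iff_continuousAt.2 fun z => ?_
    by_cases hz : z = 0
    · subst hz
      rw [ContinuousAt, radialGrad_zero]
      refine squeeze_zero_norm (a := fun z => C * ‖z‖ * ‖w‖) (fun z => ?_) ?_
      · by_cases hz : z = 0
        · simp [hz]
        · have hs := norm_pos_iff.2 hz
          exact norm_radialGrad_le w (h1 _ hs) (h2 _ hs)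
      · have : Continuous fun z : ℂ => C * ‖z‖ * ‖w‖ := by fun_prop
        simpa using this.tendsto 0
    · have hs := norm_pos_iff.2 hz
      have cn : ContinuousAt (fun z : ℂ => ‖z‖) z := continuous_norm.continuousAt
      have cf : ContinuousAt (fun z : ℂ => f ‖z‖ / ‖z‖) z :=
        ((h.continuousAt_left hs).comp (f := fun z : ℂ => ‖z‖) cn).div cn hs.ne'
      have cl : ContinuousAt (fun z : ℂ => l ‖z‖ * (f ‖z‖ / ‖z‖)) z :=
        ((h.continuousAt hs).comp (f := fun z : ℂ => ‖z‖) cn).mul cf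
      have cu := continuousAt_unitDir hz
      have cs : ContinuousAt (fun z : ℂ => star (unitDir z) * w) z :=
        (continuous_star.continuousAt.comp cu).mul continuousAt_const
      have co : ∀ {a : ℂ → ℝ}, ContinuousAt a z → ContinuousAt (fun z => (a z : ℂ)) z :=
        fun ha => Complex.continuous_ofReal.continuousAt.comp ha
      have cr : ContinuousAt (fun z : ℂ => radPart z w) z :=
        Complex.continuous_re.continuousAt.comp cs
      have ca : ContinuousAt (fun z : ℂ => angPart z w) z :=
        Complex.continuous_im.continuousAt.comp cs
      exact cu.mul (((co cl).mul (co cr)).add ((co cf).mul (continuousAt_const.mul (co ca))))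

theorem IsProfile.mul_div_add {f l : ℝ → ℝ} (h : IsProfile f l) {ε : ℝ} (hε : 0 < ε) :
    IsProfile (fun s => f s * (s / (s + ε))) (fun s => l s + ε / (s + ε)) := by
  refine ⟨fun s hs => mul_pos (h.pos s hs) (by positivity), fun s hs => ?_, ?_⟩
  · have hse : s + ε ≠ 0 := by positivity
    have h1 := (h.hasDerivAt s hs).mul
      ((hasDerivAt_id s).div ((hasDerivAt_id s).add_const ε) hse)
    refine h1.congr_deriv ?_
    simp only [id, Pi.div_apply]
    field_simp
    ring
  · refine h.continuousOn.add (continuousOn_const.div (continuousOn_id.add continuousOn_const) ?_)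
    intro s hs
    have : 0 < s := hs
    exact (add_pos this hε).ne'

/-- A Lipschitz radial map need not be differentiable at 0. Multiplying `f` by `s/(s+ε)` gives a
`C¹` map to which the chain rule applies; the bounds are uniform in `ε`, and the gradients converge
pointwise, including where `v = 0`, since there all of them vanish. -/
theorem HasH10Grad.radial {v : Space N → ℂ} {g : Space N → Fin N → ℂ}
    (h : HasH10Grad Ω v g) {f l : ℝ → ℝ} (hf : IsProfile f l) {K : ℝ}
    (h1 : ∀ s, 0 < s → f s / s ≤ K) (h2 : ∀ s, 0 < s → |l s * (f s / s)| ≤ K) :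
    HasH10Grad Ω (fun x => radialMap f (v x)) (fun x i => radialGrad f l (v x) (g x i)) := by
  have hK : 0 ≤ K := (abs_nonneg _).trans (h2 1 one_pos)
  let ε : ℕ → ℝ := fun n => 1 / ((n : ℝ) + 1)
  have hε : ∀ n, 0 < ε n := fun n => by positivity
  have hε0 : Tendsto ε atTop (𝓝 0) := tendsto_one_div_add_atTop_nhds_zero_nat
  let k : ℕ → ℝ → ℝ := fun n s => f s * (s / (s + ε n))
  let m : ℕ → ℝ → ℝ := fun n s => l s + ε n / (s + ε n)
  have hk : ∀ n, IsProfile (k n) (m n) := fun n => hf.mul_div_add (hε n)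
  have e1 : ∀ n s, 0 < s → k n s / s = f s / s * (s / (s + ε n)) := fun n s hs => by
    simp only [k]; ring
  have e2 : ∀ n s, 0 < s → m n s * (k n s / s) =
      (l s * (f s / s) + f s / s * (ε n / (s + ε n))) * (s / (s + ε n)) := fun n s hs => by
    simp only [k, m]; ring
  have q0 : ∀ n s, 0 < s → 0 ≤ s / (s + ε n) := fun n s hs => by have := hε n; positivity
  have q1 : ∀ n s, 0 < s → s / (s + ε n) ≤ 1 := fun n s hs => by
    have := hε n
    rw [div_le_one (by positivity)]; linarith
  have q2 : ∀ n s, 0 < s → s / (s + ε n) ≤ s / ε n := fun n s hs =>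
    div_le_div_of_nonneg_left hs.le (hε n) (by linarith)
  have q3 : ∀ n s, 0 < s → ε n / (s + ε n) ≤ 1 := fun n s hs => by
    have := hε n
    rw [div_le_one (by positivity)]; linarith
  have q4 : ∀ n s, 0 < s → 0 ≤ ε n / (s + ε n) := fun n s hs => by
    have := hε n; positivity
  have hB0 : ∀ s, 0 < s → 0 ≤ f s / s := fun s hs => (div_pos (hf.pos s hs) hs).le
  have b1 : ∀ n s, 0 < s → |k n s / s| ≤ 2 * K * (s / (s + ε n)) := fun n s hs => by
    rw [e1 n s hs, abs_mul, abs_of_nonneg (hB0 s hs), abs_of_nonneg (q0 n s hs)]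
    exact mul_le_mul_of_nonneg_right (by linarith [h1 s hs]) (q0 n s hs)
  -- The factor `s/(s+ε)` adds `ε/(s+ε) ≤ 1` to the logarithmic derivative, whence `2K` instead of
  -- `K`.
  have b2 : ∀ n s, 0 < s → |m n s * (k n s / s)| ≤ 2 * K * (s / (s + ε n)) := fun n s hs => by
    rw [e2 n s hs, abs_mul, abs_of_nonneg (q0 n s hs)]
    refine mul_le_mul_of_nonneg_right ((abs_add_le _ _).trans ?_) (q0 n s hs)
    rw [abs_of_nonneg (mul_nonneg (hB0 s hs) (q4 n s hs))]
    have := mul_le_of_le_one_right (hB0 s hs) (q3 n s hs)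
    linarith [h1 s hs, h2 s hs]
  have c1 : ∀ n s, 0 < s → |k n s / s| ≤ 2 * K / ε n * s := fun n s hs =>
    (b1 n s hs).trans (by
      have := mul_le_mul_of_nonneg_left (q2 n s hs) (by positivity : 0 ≤ 2 * K)
      calc _ ≤ _ := this
        _ = _ := by ring)
  have c2 : ∀ n s, 0 < s → |m n s * (k n s / s)| ≤ 2 * K / ε n * s := fun n s hs =>
    (b2 n s hs).trans (by
      have := mul_le_mul_of_nonneg_left (q2 n s hs) (by positivity : 0 ≤ 2 * K)
      calc _ ≤ _ := this
        _ = _ := by ring)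
  have d1 : ∀ n s, 0 < s → |k n s / s| ≤ 2 * K := fun n s hs =>
    (b1 n s hs).trans (mul_le_of_le_one_right (by positivity) (q1 n s hs))
  have d2 : ∀ n s, 0 < s → |m n s * (k n s / s)| ≤ 2 * K := fun n s hs =>
    (b2 n s hs).trans (mul_le_of_le_one_right (by positivity) (q1 n s hs))
  have hgr : ∀ n z w, ‖radialGrad (k n) (m n) z w‖ ≤ 2 * K * ‖w‖ := by
    intro n z w
    by_cases hz : z = 0
    · simp only [hz, radialGrad_zero, norm_zero]; positivity
    · have hs := norm_pos_iff.2 hz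
      exact norm_radialGrad_le w (d1 n _ hs) (d2 n _ hs)
  have hcd := fun n => (hk n).contDiff_radialMap (c1 n) (c2 n)
  have hstep : ∀ n, HasH10Grad Ω (fun x => radialMap (k n) (v x))
      (fun x i => radialGrad (k n) (m n) (v x) (g x i)) := by
    intro n
    have := h.comp (hcd n).1 (radialMap_zero _) (K := 2 * K) (fun z =>
      ContinuousLinearMap.opNorm_le_bound _ (by positivity) fun w => by
        rw [(hcd n).2]; exact hgr n z w)
    simpa only [(hcd n).2] using this
  refine HasH10Grad.of_dominated (G := fun x => 2 * K * ‖v x‖) (G' := fun x i => 2 * K * ‖g x i‖)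
    hstep (h.1.norm.const_mul _) (fun i => (h.2.1 i).norm.const_mul _)
    (fun n => Eventually.of_forall fun x => ?_)
    (fun n i => Eventually.of_forall fun x => hgr n _ _)
    (Eventually.of_forall fun x => ?_) (fun i => Eventually.of_forall fun x => ?_)
  · by_cases hz : v x = 0
    · simp [hz]
    · rw [radialMap, norm_mul, Complex.norm_real]
      exact mul_le_mul_of_nonneg_right (d1 n _ (norm_pos_iff.2 hz)) (norm_nonneg _)
  · by_cases hz : v x = 0
    · simp [hz]
    have hs := norm_pos_iff.2 hz
    have t1 : Tendsto (fun n => ‖v x‖ / (‖v x‖ + ε n)) atTop (𝓝 1) := by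
      have := (tendsto_const_nhds (x := ‖v x‖)).div (tendsto_const_nhds.add hε0)
        (by rw [add_zero]; exact hs.ne')
      simpa [Pi.div_def, hs.ne'] using this
    have t2 : Tendsto (fun n => k n ‖v x‖ / ‖v x‖) atTop (𝓝 (f ‖v x‖ / ‖v x‖)) := by
      simp_rw [fun n => e1 n _ hs]
      simpa using t1.const_mul (f ‖v x‖ / ‖v x‖)
    exact ((Complex.continuous_ofReal.tendsto _).comp t2).mul_const _
  · by_cases hz : v x = 0
    · simp [hz]
    have hs := norm_pos_iff.2 hz
    have t1 : Tendsto (fun n => ‖v x‖ / (‖v x‖ + ε n)) atTop (𝓝 1) := by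
      have := (tendsto_const_nhds (x := ‖v x‖)).div (tendsto_const_nhds.add hε0)
        (by rw [add_zero]; exact hs.ne')
      simpa [Pi.div_def, hs.ne'] using this
    have t0 : Tendsto (fun n => ε n / (‖v x‖ + ε n)) atTop (𝓝 0) := by
      have := hε0.div (tendsto_const_nhds.add hε0)
        (by rw [add_zero]; exact hs.ne')
      simpa [Pi.div_def, hs.ne'] using this
    have t2 : Tendsto (fun n => k n ‖v x‖ / ‖v x‖) atTop (𝓝 (f ‖v x‖ / ‖v x‖)) := by
      simp_rw [fun n => e1 n _ hs]
      simpa using t1.const_mul (f ‖v x‖ / ‖v x‖)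
    have t3 : Tendsto (fun n => m n ‖v x‖ * (k n ‖v x‖ / ‖v x‖)) atTop
        (𝓝 (l ‖v x‖ * (f ‖v x‖ / ‖v x‖))) := by
      simp_rw [fun n => e2 n _ hs]
      simpa using ((t0.const_mul (f ‖v x‖ / ‖v x‖)).const_add (l ‖v x‖ * (f ‖v x‖ / ‖v x‖))).mul t1
    exact ((((Complex.continuous_ofReal.tendsto _).comp t3).mul_const _).add
      (((Complex.continuous_ofReal.tendsto _).comp t2).mul_const _)).const_mul _

theorem isProfile_id : IsProfile (fun s => s) (fun _ => 1) :=
  ⟨fun s hs => hs, fun s hs => (hasDerivAt_id s).congr_deriv (by field_simp),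
    continuousOn_const⟩

/-- A gradient of an element of `H̊¹` vanishes almost everywhere on the zero set. -/
theorem HasH10Grad.ae_eq_zero {v : Space N → ℂ} {g : Space N → Fin N → ℂ}
    (h : HasH10Grad Ω v g) : ∀ᵐ x ∂(domVol Ω), v x = 0 → g x = 0 := by
  -- The identity map is itself radial, and its radial gradient is 0 at points where `v` vanishes;
  -- uniqueness of the weak gradient compares it with `g`.
  have h1 := h.radial isProfile_id (K := 1) (fun s hs => by rw [div_self hs.ne'])
    (fun s hs => by simp [hs.ne'])
  have e : (fun x => radialMap (fun s => s) (v x)) = v := by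
    ext x
    by_cases hz : v x = 0
    · simp [hz]
    · simp [radialMap, hz]
  rw [e] at h1
  filter_upwards [h.hasWeakGradient.ae_eq h1.hasWeakGradient] with x hx h0
  rw [hx]
  ext i
  simp [h0]

/-! ### The gradient of the modulus -/

theorem hasFDerivAt_sqrt_norm_sq_add {ε : ℝ} (hε : 0 < ε) (z : ℂ) :
    HasFDerivAt (fun w : ℂ => ((√(‖w‖ ^ 2 + ε ^ 2) - ε : ℝ) : ℂ))
      (Complex.ofRealCLM.comp ((1 / √(‖z‖ ^ 2 + ε ^ 2)) • innerSL ℝ z)) z := by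
  have h := ((hasStrictFDerivAt_norm_sq z).hasFDerivAt.add_const (ε ^ 2)).sqrt
    (by positivity)
  refine Complex.ofRealCLM.hasFDerivAt.comp z ((h.sub_const ε).congr_fderiv ?_)
  ext w
  all_goals
    simp
    field_simp

/-- The modulus is approximated by the smooth maps `√(|z|² + ε²) - ε`, which fix 0 and have
derivative `|z|/√(|z|² + ε²)` times the radial part, of norm at most 1. -/
theorem HasH10Grad.modulus {v : Space N → ℂ} {g : Space N → Fin N → ℂ}
    (h : HasH10Grad Ω v g) :
    HasH10Grad Ω (modulus v) (fun x i => (radPart (v x) (g x i) : ℂ)) := by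
  let ε : ℕ → ℝ := fun n => 1 / ((n : ℝ) + 1)
  have hε : ∀ n, 0 < ε n := fun n => by positivity
  have hε0 : Tendsto ε atTop (𝓝 0) := tendsto_one_div_add_atTop_nhds_zero_nat
  let F : ℕ → ℂ → ℂ := fun n w => ((√(‖w‖ ^ 2 + ε n ^ 2) - ε n : ℝ) : ℂ)
  have hsm : ∀ n, ContDiff ℝ (⊤ : ℕ∞) (F n) := fun n =>
    Complex.ofRealCLM.contDiff.comp ((((contDiff_norm_sq ℝ).add contDiff_const).sqrt fun z => by
      have := hε n; positivity).sub contDiff_const)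
  have hz : ∀ n, F n 0 = 0 := fun n => by simp [F, Real.sqrt_sq (hε n).le]
  have hfd : ∀ n z w, fderiv ℝ (F n) z w =
      ((‖z‖ / √(‖z‖ ^ 2 + ε n ^ 2) * radPart z w : ℝ) : ℂ) := by
    intro n z w
    rw [(hasFDerivAt_sqrt_norm_sq_add (hε n) z).fderiv]
    simp only [ContinuousLinearMap.comp_apply, _root_.smul_apply,
      innerSL_apply_apply, inner_eq_norm_mul_radPart, Complex.ofRealCLM_apply, smul_eq_mul]
    congr 1
    ring
  have hle : ∀ n (z : ℂ), ‖z‖ / √(‖z‖ ^ 2 + ε n ^ 2) ≤ 1 := by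
    intro n z
    refine div_le_one_of_le₀ (Real.le_sqrt_of_sq_le ?_) (Real.sqrt_nonneg _)
    nlinarith [sq_nonneg (ε n)]
  have hgr : ∀ n z w, ‖fderiv ℝ (F n) z w‖ ≤ 1 * ‖w‖ := by
    intro n z w
    rw [hfd, Complex.norm_real, norm_mul, Real.norm_of_nonneg (by positivity)]
    exact mul_le_mul (hle n z) (abs_radPart_le z w) (norm_nonneg _) zero_le_one
  have hK : ∀ n z, ‖fderiv ℝ (F n) z‖ ≤ 1 := fun n z =>
    ContinuousLinearMap.opNorm_le_bound _ zero_le_one (hgr n z)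
  refine HasH10Grad.of_dominated (G := fun x => 1 * ‖v x‖) (G' := fun x i => 1 * ‖g x i‖)
    (fun n => h.comp_smooth (hsm n) (hz n) (hK n)) (h.1.norm.const_mul _)
    (fun i => (h.2.1 i).norm.const_mul _) (fun n => Eventually.of_forall fun x => ?_)
    (fun n i => Eventually.of_forall fun x => hgr n _ _)
    (Eventually.of_forall fun x => ?_) (fun i => Eventually.of_forall fun x => ?_)
  · simpa [hz n] using norm_sub_le_of_norm_fderiv_le ((hsm n).differentiable (by simp))
      (hK n) (v x) 0
  · have t : Tendsto (fun n => √(‖v x‖ ^ 2 + ε n ^ 2) - ε n) atTop (𝓝 ‖v x‖) := by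
      have := ((Real.continuous_sqrt.tendsto _).comp
        ((hε0.pow 2).const_add (‖v x‖ ^ 2))).sub hε0
      simpa [Function.comp_def] using this
    exact (Complex.continuous_ofReal.tendsto _).comp t
  · simp_rw [hfd]
    by_cases h0 : v x = 0
    · simp [h0]
    have hs := norm_pos_iff.2 h0
    have t : Tendsto (fun n => ‖v x‖ / √(‖v x‖ ^ 2 + ε n ^ 2)) atTop (𝓝 1) := by
      have := (tendsto_const_nhds (x := ‖v x‖)).div ((Real.continuous_sqrt.tendsto _).comp
        ((hε0.pow 2).const_add (‖v x‖ ^ 2))) (by simp [h0])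
      simpa [Pi.div_def, Function.comp_def, hs.ne'] using this
    have := t.mul_const (radPart (v x) (g x i))
    rw [one_mul] at this
    exact (Complex.continuous_ofReal.tendsto _).comp this

/-! ### Calculus of profiles -/

theorem IsProfile.comp {f l k m : ℝ → ℝ} (hk : IsProfile k m) (hf : IsProfile f l) :
    IsProfile (fun s => k (f s)) (fun s => m (f s) * l s) := by
  refine ⟨fun s hs => hk.pos _ (hf.pos s hs), fun s hs => ?_, ?_⟩
  · have hfs := hf.pos s hs
    refine ((hk.hasDerivAt _ hfs).comp s (hf.hasDerivAt s hs)).congr_deriv ?_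
    field_simp
  · exact (hk.continuousOn.comp hf.continuousOn_left fun s hs => hf.pos s hs).mul hf.continuousOn

theorem IsProfile.mul {f l k m : ℝ → ℝ} (hf : IsProfile f l) (hk : IsProfile k m) :
    IsProfile (fun s => f s * k s) (fun s => l s + m s) := by
  refine ⟨fun s hs => mul_pos (hf.pos s hs) (hk.pos s hs), fun s hs => ?_,
    hf.continuousOn.add hk.continuousOn⟩
  refine ((hf.hasDerivAt s hs).mul (hk.hasDerivAt s hs)).congr_deriv ?_
  field_simp

theorem IsProfile.add {f l k m : ℝ → ℝ} (hf : IsProfile f l) (hk : IsProfile k m) :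
    IsProfile (fun s => f s + k s) (fun s => (l s * f s + m s * k s) / (f s + k s)) := by
  refine ⟨fun s hs => add_pos (hf.pos s hs) (hk.pos s hs), fun s hs => ?_, ?_⟩
  · have := add_pos (hf.pos s hs) (hk.pos s hs)
    refine ((hf.hasDerivAt s hs).add (hk.hasDerivAt s hs)).congr_deriv ?_
    field_simp
  · exact ((hf.continuousOn.mul hf.continuousOn_left).add
      (hk.continuousOn.mul hk.continuousOn_left)).div
      (hf.continuousOn_left.add hk.continuousOn_left)
      fun s hs => (add_pos (hf.pos s hs) (hk.pos s hs)).ne'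

theorem IsProfile.sqrt {f l : ℝ → ℝ} (hf : IsProfile f l) :
    IsProfile (fun s => √(f s)) (fun s => l s / 2) := by
  refine ⟨fun s hs => Real.sqrt_pos.2 (hf.pos s hs), fun s hs => ?_,
    hf.continuousOn.div_const 2⟩
  have hp := hf.pos s hs
  have hq := Real.sqrt_pos.2 hp
  refine ((hf.hasDerivAt s hs).sqrt hp.ne').congr_deriv ?_
  have h2 : f s = √(f s) * √(f s) := (Real.mul_self_sqrt hp.le).symm
  rw [div_eq_div_iff (by positivity) hs.ne']
  nth_rewrite 1 [h2]
  field_simp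

theorem IsProfile.congr {f l l' : ℝ → ℝ} (hf : IsProfile f l) (h : ∀ s, 0 < s → l s = l' s) :
    IsProfile f l' :=
  ⟨hf.pos, fun s hs => h s hs ▸ hf.hasDerivAt s hs,
    hf.continuousOn.congr fun s hs => (h s hs).symm⟩

theorem IsProfile.strictMonoOn {f l : ℝ → ℝ} (hf : IsProfile f l) (hl : ∀ s, 0 < s → 0 < l s) :
    StrictMonoOn f (Ioi 0) := by
  refine strictMonoOn_of_deriv_pos (convex_Ioi 0) hf.continuousOn_left fun s hs => ?_
  rw [interior_Ioi] at hs
  rw [(hf.hasDerivAt s hs).deriv]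
  exact div_pos (mul_pos (hl s hs) (hf.pos s hs)) hs

theorem IsProfile.surjOn {f l : ℝ → ℝ} (hf : IsProfile f l)
    (h1 : ∀ t, 0 < t → ∃ s, 0 < s ∧ f s ≤ t) (h2 : ∀ t, 0 < t → ∃ s, 0 < s ∧ t ≤ f s) :
    SurjOn f (Ioi 0) (Ioi 0) := by
  intro t ht
  obtain ⟨s₁, hs₁, h₁⟩ := h1 t ht
  obtain ⟨s₂, hs₂, h₂⟩ := h2 t ht
  exact isPreconnected_Ioi.intermediate_value hs₁ hs₂ hf.continuousOn_left ⟨h₁, h₂⟩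

section Inverse

variable {f l : ℝ → ℝ}

theorem invFunOn_pos (hs : SurjOn f (Ioi 0) (Ioi 0)) {t : ℝ} (ht : 0 < t) :
    0 < Function.invFunOn f (Ioi 0) t :=
  Function.invFunOn_mem (hs ht)

theorem apply_invFunOn (hs : SurjOn f (Ioi 0) (Ioi 0)) {t : ℝ} (ht : 0 < t) :
    f (Function.invFunOn f (Ioi 0) t) = t :=
  Function.invFunOn_eq (hs ht)

theorem IsProfile.invFunOn_apply (hf : IsProfile f l) (hl : ∀ s, 0 < s → 0 < l s)
    (hs : SurjOn f (Ioi 0) (Ioi 0)) {s : ℝ} (h : 0 < s) :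
    Function.invFunOn f (Ioi 0) (f s) = s :=
  (hf.strictMonoOn hl).injOn (invFunOn_pos hs (hf.pos s h)) h (apply_invFunOn hs (hf.pos s h))

theorem IsProfile.invFunOn (hf : IsProfile f l) (hl : ∀ s, 0 < s → 0 < l s)
    (hs : SurjOn f (Ioi 0) (Ioi 0)) :
    IsProfile (Function.invFunOn f (Ioi 0))
      (fun t => 1 / l (Function.invFunOn f (Ioi 0) t)) := by
  set k := Function.invFunOn f (Ioi 0) with hk
  have kpos : ∀ t, 0 < t → 0 < k t := fun t ht => invFunOn_pos hs ht
  have fk : ∀ t, 0 < t → f (k t) = t := fun t ht => apply_invFunOn hs ht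
  have kf : ∀ s, 0 < s → k (f s) = s := fun s h => hf.invFunOn_apply hl hs h
  have hmono : StrictMonoOn k (Ioi 0) := by
    intro a ha b hb hab
    refine (hf.strictMonoOn hl).lt_iff_lt (kpos a ha) (kpos b hb) |>.1 ?_
    rwa [fk a ha, fk b hb]
  have hcont : ∀ t, 0 < t → ContinuousAt k t := by
    intro t ht
    refine hmono.continuousAt_of_image_mem_nhds (Ioi_mem_nhds ht) ?_
    refine Filter.mem_of_superset (Ioi_mem_nhds (kpos t ht)) fun s h => ?_
    exact ⟨f s, hf.pos s h, kf s h⟩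
  refine ⟨kpos, fun t ht => ?_, ?_⟩
  · have hd := hf.hasDerivAt _ (kpos t ht)
    rw [fk t ht] at hd
    have hlp := hl _ (kpos t ht)
    have hkp := kpos t ht
    refine (hd.of_local_left_inverse (hcont t ht) (by positivity) ?_).congr_deriv ?_
    · filter_upwards [Ioi_mem_nhds ht] with y hy using fk y hy
    · field_simp
  · refine continuousOn_const.div (hf.continuousOn.comp
      (fun t ht => (hcont t ht).continuousWithinAt) fun t ht => kpos t ht)
      fun t ht => (hl _ (kpos t ht)).ne'

end Inverse

/-! ### Truncation at infinity and damping at zero. -/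

/-- The truncation `s ↦ c s / (s + c)`, bounded by `s` and by `c`. -/
def softMin (c s : ℝ) : ℝ := s * (c / (s + c))

theorem isProfile_softMin {c : ℝ} (hc : 0 < c) :
    IsProfile (softMin c) (fun s => c / (s + c)) := by
  refine ⟨fun s hs => mul_pos hs (by positivity), fun s hs => ?_, ?_⟩
  · have hsc : s + c ≠ 0 := by positivity
    have := (hasDerivAt_id s).mul ((hasDerivAt_const s c).div ((hasDerivAt_id s).add_const c) hsc)
    refine this.congr_deriv ?_
    simp only [softMin, id, Pi.div_apply]
    field_simp
    ring
  · exact continuousOn_const.div (continuousOn_id.add continuousOn_const)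
      fun s hs => (add_pos hs hc).ne'

theorem softMin_le_left {c s : ℝ} (hc : 0 < c) (hs : 0 < s) : softMin c s ≤ s :=
  mul_le_of_le_one_right hs.le ((div_le_one (by positivity)).2 (by linarith))

theorem softMin_le_right {c s : ℝ} (hc : 0 < c) (hs : 0 < s) : softMin c s ≤ c := by
  rw [softMin, mul_div_assoc', div_le_iff₀ (by positivity)]
  nlinarith

theorem tendsto_div_add_nat (s : ℝ) :
    Tendsto (fun n : ℕ => ((n : ℝ) + 1) / (s + ((n : ℝ) + 1))) atTop (𝓝 1) := by
  have h1 : Tendsto (fun n : ℕ => (n : ℝ) + 1) atTop atTop :=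
    tendsto_atTop_add_const_right _ _ tendsto_natCast_atTop_atTop
  have h2 : Tendsto (fun n : ℕ => s + ((n : ℝ) + 1)) atTop atTop :=
    tendsto_atTop_add_const_left _ _ h1
  have h3 := (tendsto_const_nhds (x := (1 : ℝ))).sub (h2.const_div_atTop s)
  rw [sub_zero] at h3
  refine h3.congr' ?_
  filter_upwards [h2.eventually_gt_atTop 0] with n hn
  field_simp
  ring

theorem tendsto_softMin (s : ℝ) :
    Tendsto (fun n : ℕ => softMin ((n : ℝ) + 1) s) atTop (𝓝 s) := by
  simpa [softMin] using (tendsto_div_add_nat s).const_mul s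

/-- Half the harmonic mean of `f s` and `c s`. -/
def harmonicMin (c : ℝ) (f : ℝ → ℝ) (s : ℝ) : ℝ := f s * (c * s / (f s + c * s))

/-- The logarithmic derivative is the mean of `l s` and 1 with weights `c s` and `f s`, so an upper
bound of at least 1 on `l` is inherited uniformly in `c`. -/
theorem IsProfile.harmonicMin {f l : ℝ → ℝ} (hf : IsProfile f l) {c : ℝ} (hc : 0 < c) :
    IsProfile (harmonicMin c f) (fun s => (l s * (c * s) + f s) / (f s + c * s)) := by
  have hp : ∀ s, 0 < s → 0 < f s + c * s := fun s hs => add_pos (hf.pos s hs) (by positivity)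
  refine ⟨fun s hs => mul_pos (hf.pos s hs) (div_pos (by positivity) (hp s hs)),
    fun s hs => ?_, ?_⟩
  · have hsc := (hp s hs).ne'
    have hcs := (hasDerivAt_id s).const_mul c
    have := (hf.hasDerivAt s hs).mul (hcs.div ((hf.hasDerivAt s hs).add hcs) hsc)
    refine this.congr_deriv ?_
    simp only [FunctionalDissipativity.harmonicMin, id, Pi.div_apply, Pi.add_apply]
    field_simp
    ring
  · have hcc : ContinuousOn (fun s : ℝ => c * s) (Ioi 0) := by fun_prop
    exact ((hf.continuousOn.mul hcc).add hf.continuousOn_left).div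
      (hf.continuousOn_left.add hcc) fun s hs => (hp s hs).ne'

theorem harmonicMin_le_left {f : ℝ → ℝ} {c s : ℝ} (hf : 0 < f s) (hc : 0 < c) (hs : 0 < s) :
    harmonicMin c f s ≤ f s :=
  mul_le_of_le_one_right hf.le ((div_le_one (by positivity)).2 (by linarith))

theorem harmonicMin_le_right {f : ℝ → ℝ} {c s : ℝ} (hf : 0 < f s) (hc : 0 < c) (hs : 0 < s) :
    harmonicMin c f s ≤ c * s := by
  have : 0 < c * s := by positivity
  rw [harmonicMin, mul_div_assoc', div_le_iff₀ (by positivity)]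
  nlinarith

theorem tendsto_harmonicMin (f : ℝ → ℝ) {s : ℝ} (hs : 0 < s) :
    Tendsto (fun n : ℕ => harmonicMin ((n : ℝ) + 1) f s) atTop (𝓝 (f s)) := by
  have h := (tendsto_div_add_nat (f s / s)).const_mul (f s)
  rw [mul_one] at h
  refine h.congr fun n => ?_
  rw [harmonicMin]
  congr 1
  field_simp

theorem tendsto_harmonicMin_logDeriv (a b : ℝ) {s : ℝ} (hs : 0 < s) :
    Tendsto (fun n : ℕ => (a * (((n : ℝ) + 1) * s) + b) / (b + ((n : ℝ) + 1) * s)) atTop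
      (𝓝 a) := by
  have h1 : Tendsto (fun n : ℕ => (n : ℝ) + 1) atTop atTop :=
    tendsto_atTop_add_const_right _ _ tendsto_natCast_atTop_atTop
  have h2 : Tendsto (fun n : ℕ => b + ((n : ℝ) + 1) * s) atTop atTop :=
    tendsto_atTop_add_const_left _ _ (h1.atTop_mul_const hs)
  have h3 := (h2.const_div_atTop (b - a * b)).const_add a
  rw [add_zero] at h3
  refine h3.congr' ?_
  filter_upwards [h2.eventually_gt_atTop 0] with n hn
  field_simp
  ring

/-! ### The functions attached to `φ` -/

/-- The logarithmic derivative of `φ`. -/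
def logDer (φ : ℝ → ℝ) (s : ℝ) : ℝ := s * deriv φ s / φ s

namespace Admissible

variable {φ : ℝ → ℝ}

theorem isProfile (hφ : Admissible φ) : IsProfile φ (logDer φ) := by
  have hd : ∀ s, 0 < s → DifferentiableAt ℝ φ s := fun s hs =>
    (hφ.contDiffOn.differentiableOn one_ne_zero).differentiableAt (Ioi_mem_nhds hs)
  refine ⟨hφ.pos, fun s hs => ?_, ?_⟩
  · refine (hd s hs).hasDerivAt.congr_deriv ?_
    have := hφ.pos s hs
    rw [logDer]
    field_simp
  · exact (continuousOn_id.mul (hφ.contDiffOn.continuousOn_deriv_of_isOpen isOpen_Ioi le_rfl)).div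
      hφ.contDiffOn.continuousOn fun s hs => (hφ.pos s hs).ne'

theorem isProfile_mul (hφ : Admissible φ) :
    IsProfile (fun s => s * φ s) (fun s => 1 + logDer φ s) :=
  isProfile_id.mul hφ.isProfile

theorem logDer_pos (hφ : Admissible φ) {s : ℝ} (hs : 0 < s) : 0 < 1 + logDer φ s := by
  have h1 := hφ.deriv_pos s hs
  rw [(hφ.isProfile_mul.hasDerivAt s hs).deriv] at h1
  have h2 := hφ.pos s hs
  have h3 : (1 + logDer φ s) * (s * φ s) / s = (1 + logDer φ s) * φ s := by field_simp
  rw [h3] at h1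
  exact (pos_iff_pos_of_mul_pos h1).2 h2

theorem mul_monotoneOn (hφ : Admissible φ) : MonotoneOn (fun s => s * φ s) (Ioi 0) :=
  (hφ.isProfile_mul.strictMonoOn fun _ => hφ.logDer_pos).monotoneOn

theorem exists_mul_eq (hφ : Admissible φ) {t : ℝ} (ht : 0 < t) : ∃ s, 0 < s ∧ s * φ s = t := by
  have : t ∈ (fun s => s * φ s) '' Ioi 0 := by rw [hφ.range_eq]; exact ht
  obtain ⟨s, hs, h⟩ := this
  exact ⟨s, hs, h⟩

theorem isProfile_mul_sqrt (hφ : Admissible φ) :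
    IsProfile (fun s => s * √(φ s)) (fun s => 1 + logDer φ s / 2) :=
  isProfile_id.mul hφ.isProfile.sqrt

theorem mul_sqrt_sq (hφ : Admissible φ) {s : ℝ} (hs : 0 < s) :
    (s * √(φ s)) ^ 2 = s * (s * φ s) := by
  rw [mul_pow, Real.sq_sqrt (hφ.pos s hs).le]
  ring

/-- The square of `s√φ(s)` is `s · sφ(s)`. Choosing `sφ(s) = t²` and then capping `s` by 1 from
above, or from below, gives a value at most, or at least, `t`. -/
theorem surjOn_mul_sqrt (hφ : Admissible φ) :
    SurjOn (fun s => s * √(φ s)) (Ioi 0) (Ioi 0) := by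
  refine hφ.isProfile_mul_sqrt.surjOn (fun t ht => ?_) fun t ht => ?_
  · obtain ⟨s, hs, hst⟩ := hφ.exists_mul_eq (pow_pos ht 2)
    have hm : 0 < min s 1 := lt_min hs one_pos
    refine ⟨min s 1, hm, ?_⟩
    refine abs_le_of_sq_le_sq' ?_ ht.le |>.2
    rw [hφ.mul_sqrt_sq hm]
    have h1 := hφ.mul_monotoneOn hm hs (min_le_left _ _)
    simp only [hst] at h1
    have h2 : 0 < min s 1 * φ (min s 1) := mul_pos hm (hφ.pos _ hm)
    nlinarith [min_le_right s 1]
  · obtain ⟨s, hs, hst⟩ := hφ.exists_mul_eq (pow_pos ht 2)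
    have hm : 0 < max s 1 := lt_max_of_lt_left hs
    refine ⟨max s 1, hm, ?_⟩
    refine abs_le_of_sq_le_sq' ?_ (mul_nonneg hm.le (Real.sqrt_nonneg _)) |>.2
    rw [hφ.mul_sqrt_sq hm]
    have h1 := hφ.mul_monotoneOn hs hm (le_max_left _ _)
    simp only [hst] at h1
    nlinarith [le_max_right s 1, sq_nonneg t]

theorem logDer_half_pos (hφ : Admissible φ) {s : ℝ} (hs : 0 < s) : 1 / 2 < 1 + logDer φ s / 2 := by
  linarith [hφ.logDer_pos hs]

theorem isProfile_zeta (hφ : Admissible φ) :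
    IsProfile (zeta φ) (fun t => 1 / (1 + logDer φ (zeta φ t) / 2)) :=
  hφ.isProfile_mul_sqrt.invFunOn (fun s hs => by linarith [hφ.logDer_half_pos hs])
    hφ.surjOn_mul_sqrt

theorem zeta_apply (hφ : Admissible φ) {s : ℝ} (hs : 0 < s) : zeta φ (s * √(φ s)) = s :=
  hφ.isProfile_mul_sqrt.invFunOn_apply (fun s hs => by linarith [hφ.logDer_half_pos hs])
    hφ.surjOn_mul_sqrt hs

theorem apply_zeta (hφ : Admissible φ) {t : ℝ} (ht : 0 < t) : zeta φ t * √(φ (zeta φ t)) = t :=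
  apply_invFunOn hφ.surjOn_mul_sqrt ht

/-- Division by `t` lowers a logarithmic derivative by 1, so `1 + Λ` is the logarithmic derivative
of `ζ`, the reciprocal of that of `s√φ(s)`. -/
theorem one_add_Lambda (hφ : Admissible φ) {t : ℝ} (ht : 0 < t) :
    1 + Lambda φ t = 1 / (1 + logDer φ (zeta φ t) / 2) := by
  have hz := hφ.isProfile_zeta
  have h0 := hz.pos t ht
  have h1 : HasDerivAt (Theta φ) _ t := (hz.hasDerivAt t ht).div (hasDerivAt_id t) ht.ne'
  rw [Lambda, h1.deriv, Theta]
  have := hφ.logDer_half_pos h0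
  have h2 : 1 + logDer φ (zeta φ t) / 2 ≠ 0 := by linarith
  generalize 1 + logDer φ (zeta φ t) / 2 = d at h2 ⊢
  field_simp
  ring

theorem continuousOn_Lambda (hφ : Admissible φ) : ContinuousOn (Lambda φ) (Ioi 0) := by
  refine (hφ.isProfile_zeta.continuousOn.sub (continuousOn_const (c := (1 : ℝ)))).congr fun t ht => ?_
  exact eq_sub_of_add_eq' (hφ.one_add_Lambda ht)

/-- Monotonicity of `sφ(s)` makes the logarithmic derivative of `s√φ(s)` exceed `1/2`, so that `1 +
Λ` lies between 0 and 2. -/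
theorem abs_Lambda_le (hφ : Admissible φ) {t : ℝ} (ht : 0 < t) : |Lambda φ t| ≤ 1 := by
  have h := hφ.one_add_Lambda ht
  have h1 := hφ.logDer_half_pos (hφ.isProfile_zeta.pos t ht)
  have h2 : 1 / (1 + logDer φ (zeta φ t) / 2) ≤ 2 := by
    rw [div_le_iff₀ (by linarith)]; linarith
  have h3 : 0 < 1 / (1 + logDer φ (zeta φ t) / 2) := div_pos one_pos (by linarith)
  rw [abs_le]
  constructor <;> linarith

/-! ### The splitting of `y > 0` as `s + sφ(s)`. -/

theorem isProfile_sum (hφ : Admissible φ) : IsProfile (fun s => s + s * φ s)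
    (fun s => (1 + (1 + logDer φ s) * φ s) / (1 + φ s)) := by
  refine (isProfile_id.add hφ.isProfile_mul).congr fun s hs => ?_
  have := hφ.pos s hs
  field_simp

theorem surjOn_sum (hφ : Admissible φ) : SurjOn (fun s => s + s * φ s) (Ioi 0) (Ioi 0) := by
  refine hφ.isProfile_sum.surjOn (fun t ht => ?_) fun t ht => ⟨t, ht, ?_⟩
  · obtain ⟨s, hs, hst⟩ := hφ.exists_mul_eq (half_pos ht)
    have hm : 0 < min s (t / 2) := lt_min hs (half_pos ht)
    refine ⟨min s (t / 2), hm, ?_⟩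
    have h1 := hφ.mul_monotoneOn hm hs (min_le_left _ _)
    simp only [hst] at h1
    linarith [min_le_right s (t / 2)]
  · exact le_add_of_nonneg_right (mul_pos ht (hφ.pos t ht)).le

/-- The inverse of `s ↦ s + s φ(s)`. -/
def sumInv (φ : ℝ → ℝ) : ℝ → ℝ := Function.invFunOn (fun s => s + s * φ s) (Ioi 0)

/-- The logarithmic derivative of `sumInv φ`. -/
def sumInvLog (φ : ℝ → ℝ) (y : ℝ) : ℝ :=
  1 / ((1 + (1 + logDer φ (sumInv φ y)) * φ (sumInv φ y)) / (1 + φ (sumInv φ y)))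

theorem sum_logDer_pos (hφ : Admissible φ) {s : ℝ} (hs : 0 < s) :
    0 < (1 + (1 + logDer φ s) * φ s) / (1 + φ s) := by
  have h1 := hφ.pos s hs
  have h2 := hφ.logDer_pos hs
  positivity

theorem isProfile_sumInv (hφ : Admissible φ) : IsProfile (sumInv φ) (sumInvLog φ) :=
  hφ.isProfile_sum.invFunOn (fun _ => hφ.sum_logDer_pos) hφ.surjOn_sum

theorem sumInv_apply (hφ : Admissible φ) {s : ℝ} (hs : 0 < s) : sumInv φ (s + s * φ s) = s :=
  hφ.isProfile_sum.invFunOn_apply (fun _ => hφ.sum_logDer_pos) hφ.surjOn_sum hs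

theorem apply_sumInv (hφ : Admissible φ) {y : ℝ} (hy : 0 < y) :
    sumInv φ y + sumInv φ y * φ (sumInv φ y) = y :=
  apply_invFunOn hφ.surjOn_sum hy

/-- `y - sumInv φ y`, in the form `s φ(s)` with `s = sumInv φ y`. -/
def sumInv' (φ : ℝ → ℝ) (y : ℝ) : ℝ := sumInv φ y * φ (sumInv φ y)

/-- The logarithmic derivative of `sumInv' φ`. -/
def sumInvLog' (φ : ℝ → ℝ) (y : ℝ) : ℝ := (1 + logDer φ (sumInv φ y)) * sumInvLog φ y

theorem isProfile_sumInv' (hφ : Admissible φ) : IsProfile (sumInv' φ) (sumInvLog' φ) :=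
  hφ.isProfile_mul.comp hφ.isProfile_sumInv

theorem sumInvLog_pos (hφ : Admissible φ) {y : ℝ} (hy : 0 < y) : 0 < sumInvLog φ y :=
  one_div_pos.2 (hφ.sum_logDer_pos (hφ.isProfile_sumInv.pos y hy))

theorem sumInvLog'_pos (hφ : Admissible φ) {y : ℝ} (hy : 0 < y) : 0 < sumInvLog' φ y :=
  mul_pos (hφ.logDer_pos (hφ.isProfile_sumInv.pos y hy)) (hφ.sumInvLog_pos hy)

/-- This is `y` times the derivative of the identity `sumInv + sumInv' = y`. Both terms being
positive, each is at most `y`: the two pieces are 1-Lipschitz functions of the sum, whatever the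
behaviour of `φ`. -/
theorem sumInvLog_add (hφ : Admissible φ) {y : ℝ} (hy : 0 < y) :
    sumInvLog φ y * sumInv φ y + sumInvLog' φ y * sumInv' φ y = y := by
  have hs := hφ.isProfile_sumInv.pos y hy
  have h1 := hφ.pos _ hs
  have h2 := hφ.logDer_pos hs
  conv_rhs => rw [← hφ.apply_sumInv hy]
  rw [sumInvLog', sumInv', sumInvLog]
  generalize sumInv φ y = s at *
  generalize 1 + logDer φ s = d at *
  field_simp

theorem sumInvLog_mul_le (hφ : Admissible φ) {y : ℝ} (hy : 0 < y) :
    sumInvLog φ y * sumInv φ y ≤ y := by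
  have := mul_pos (hφ.sumInvLog'_pos hy) (hφ.isProfile_sumInv'.pos y hy)
  linarith [hφ.sumInvLog_add hy]

theorem sumInvLog'_mul_le (hφ : Admissible φ) {y : ℝ} (hy : 0 < y) :
    sumInvLog' φ y * sumInv' φ y ≤ y := by
  have := mul_pos (hφ.sumInvLog_pos hy) (hφ.isProfile_sumInv.pos y hy)
  linarith [hφ.sumInvLog_add hy]

theorem sumInv_add (hφ : Admissible φ) {y : ℝ} (hy : 0 < y) : sumInv φ y + sumInv' φ y = y :=
  hφ.apply_sumInv hy

/-! ### Bounds for the logarithmic derivatives on bounded intervals. -/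

/-- Near `0`, the function `s φ(s)` is comparable to `s` times its derivative. -/
theorem exists_logDer_bounds_near_zero (hφ : Admissible φ) :
    ∃ c C s₀ : ℝ, 0 < c ∧ 0 < s₀ ∧ ∀ s, 0 < s → s < s₀ →
      c ≤ 1 + logDer φ s ∧ 1 + logDer φ s ≤ C := by
  obtain ⟨C₁, C₂, r, s₀, hC₁, hC₂, hr, hs₀, hb, -⟩ := hφ.near_zero
  have hr1 : 0 < r + 1 := by linarith
  have hG := hφ.isProfile_mul
  have hpow : ∀ C s : ℝ, 0 < s →
      HasDerivAt (fun s : ℝ => C / (r + 1) * s ^ (r + 1)) (C * s ^ r) s := by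
    intro C s hs
    refine ((Real.hasDerivAt_rpow_const (Or.inl hs.ne')).const_mul (C / (r + 1))).congr_deriv ?_
    rw [add_sub_cancel_right]
    field_simp
  have hmono : ∀ H H' : ℝ → ℝ, (∀ s ∈ Ioo 0 s₀, HasDerivAt H (H' s) s) →
      (∀ s ∈ Ioo 0 s₀, 0 ≤ H' s) → MonotoneOn H (Ioo 0 s₀) := by
    intro H H' hd hn
    refine monotoneOn_of_deriv_nonneg (convex_Ioo 0 s₀)
      (fun s hs => (hd s hs).continuousAt.continuousWithinAt) ?_ ?_
    · intro s hs
      rw [interior_Ioo] at hs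
      exact (hd s hs).differentiableAt.differentiableWithinAt
    · intro s hs
      rw [interior_Ioo] at hs
      rw [(hd s hs).deriv]
      exact hn s hs
  have hdG : ∀ s ∈ Ioo 0 s₀, HasDerivAt (fun s => s * φ s) (deriv (fun s => s * φ s) s) s :=
    fun s hs => (hG.hasDerivAt s hs.1).differentiableAt.hasDerivAt
  -- Integration of the upper bound from 0. That `sφ(s)` tends to 0 enters through surjectivity: it
  -- takes every value `δ > 0` at some point `e`, from which one integrates if `e ≤ s`.
  have hup : ∀ s ∈ Ioo 0 s₀, s * φ s ≤ C₂ / (r + 1) * s ^ (r + 1) := by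
    have hm := hmono (fun s => C₂ / (r + 1) * s ^ (r + 1) - s * φ s) _
      (fun s hs => (hpow C₂ s hs.1).sub (hdG s hs)) fun s hs => sub_nonneg.2 (hb s hs).2
    intro s hs
    refine le_of_forall_pos_le_add fun δ hδ => ?_
    obtain ⟨e, he, heq⟩ := hφ.exists_mul_eq hδ
    have hnn : 0 ≤ C₂ / (r + 1) * s ^ (r + 1) :=
      mul_nonneg (by positivity) (Real.rpow_nonneg hs.1.le _)
    have hnn' : 0 ≤ C₂ / (r + 1) * e ^ (r + 1) :=
      mul_nonneg (by positivity) (Real.rpow_nonneg he.le _)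
    rcases le_total e s with h | h
    · have := hm ⟨he, h.trans_lt hs.2⟩ hs h
      simp only [heq] at this
      linarith
    · have := hφ.mul_monotoneOn hs.1 he h
      simp only [heq] at this
      linarith
  -- Integration of the lower bound from `e` to `s`; as `e → 0`, positivity of `eφ(e)` and `r + 1 >
  -- 0` suffice.
  have hlow : ∀ s ∈ Ioo 0 s₀, C₁ / (r + 1) * s ^ (r + 1) ≤ s * φ s := by
    have hm := hmono (fun s => s * φ s - C₁ / (r + 1) * s ^ (r + 1)) _
      (fun s hs => (hdG s hs).sub (hpow C₁ s hs.1)) fun s hs => sub_nonneg.2 (hb s hs).1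
    intro s hs
    have ht : Tendsto (fun e : ℝ => C₁ / (r + 1) * e ^ (r + 1)) (𝓝[>] 0) (𝓝 0) := by
      have := ((Real.continuousAt_rpow_const 0 (r + 1) (Or.inr hr1.le)).tendsto.const_mul
        (C₁ / (r + 1))).mono_left (nhdsWithin_le_nhds (s := Ioi 0))
      simpa [Real.zero_rpow hr1.ne'] using this
    have ev : ∀ᶠ e in 𝓝[>] (0 : ℝ), C₁ / (r + 1) * s ^ (r + 1) ≤
        s * φ s + C₁ / (r + 1) * e ^ (r + 1) := by
      filter_upwards [Ioo_mem_nhdsGT hs.1] with e he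
      have h1 := hm ⟨he.1, he.2.trans hs.2⟩ hs he.2.le
      simp only at h1
      have h2 := hG.pos e he.1
      linarith
    have := ge_of_tendsto (ht.const_add (s * φ s)) ev
    simpa using this
  -- Quotients of the bounds on `s` times the derivative of `sφ(s)` by the integrated bounds on
  -- `sφ(s)`.
  refine ⟨C₁ * (r + 1) / C₂, C₂ * (r + 1) / C₁, s₀, by positivity, hs₀, fun s h1 h2 => ?_⟩
  have hs : s ∈ Ioo 0 s₀ := ⟨h1, h2⟩
  have hd := hb s hs
  rw [(hG.hasDerivAt s h1).deriv] at hd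
  have hp : 0 < s ^ (r + 1) := Real.rpow_pos_of_pos h1 _
  have he : s ^ (r + 1) = s ^ r * s := by rw [Real.rpow_add h1, Real.rpow_one]
  have hGp := hG.pos s h1
  have hd1 : C₁ * s ^ (r + 1) ≤ (1 + logDer φ s) * (s * φ s) := by
    have := mul_le_mul_of_nonneg_right hd.1 h1.le
    rw [div_mul_cancel₀ _ h1.ne'] at this
    rw [he]; linarith
  have hd2 : (1 + logDer φ s) * (s * φ s) ≤ C₂ * s ^ (r + 1) := by
    have := mul_le_mul_of_nonneg_right hd.2 h1.le
    rw [div_mul_cancel₀ _ h1.ne'] at this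
    rw [he]; linarith
  have hlp := hφ.logDer_pos h1
  constructor
  · have h3 := mul_le_mul_of_nonneg_left (hup s hs) hlp.le
    have h4 : C₁ * s ^ (r + 1) ≤ (1 + logDer φ s) * (C₂ / (r + 1)) * s ^ (r + 1) := by linarith
    have h5 := le_of_mul_le_mul_right h4 hp
    rw [div_le_iff₀ hC₂]
    rw [mul_div_assoc', le_div_iff₀ hr1] at h5
    exact h5
  · have h3 := mul_le_mul_of_nonneg_left (hlow s hs) hlp.le
    have h4 : (1 + logDer φ s) * (C₁ / (r + 1)) * s ^ (r + 1) ≤ C₂ * s ^ (r + 1) := by linarith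
    have h5 := le_of_mul_le_mul_right h4 hp
    rw [le_div_iff₀ hC₁]
    rw [mul_div_assoc', div_le_iff₀ hr1] at h5
    exact h5

/-- The bounds near 0 are completed by compactness of `[s₀/2, S]`, where the continuous function `1
+ logDer φ` has a positive minimum. -/
theorem exists_logDer_bounds (hφ : Admissible φ) (S : ℝ) :
    ∃ c C : ℝ, 0 < c ∧ ∀ s, 0 < s → s ≤ S → c ≤ 1 + logDer φ s ∧ 1 + logDer φ s ≤ C := by
  obtain ⟨c, C, s₀, hc, hs₀, h⟩ := hφ.exists_logDer_bounds_near_zero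
  have hco : ContinuousOn (fun s => 1 + logDer φ s) (Icc (s₀ / 2) S) :=
    hφ.isProfile_mul.continuousOn.mono fun s hs => (half_pos hs₀).trans_le hs.1
  rcases (Icc (s₀ / 2) S).eq_empty_or_nonempty with he | hne
  · refine ⟨c, C, hc, fun s h1 h2 => h s h1 ?_⟩
    have := Icc_eq_empty_iff.1 he
    linarith
  · obtain ⟨a, ha, hmin⟩ := isCompact_Icc.exists_isMinOn hne hco
    obtain ⟨b, hb, hmax⟩ := isCompact_Icc.exists_isMaxOn hne hco
    have hap := hφ.logDer_pos ((half_pos hs₀).trans_le ha.1)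
    refine ⟨min c (1 + logDer φ a), max C (1 + logDer φ b), lt_min hc hap, fun s h1 h2 => ?_⟩
    rcases lt_or_ge s (s₀ / 2) with h3 | h3
    · have := h s h1 (by linarith)
      exact ⟨(min_le_left _ _).trans this.1, this.2.trans (le_max_left _ _)⟩
    · exact ⟨(min_le_right _ _).trans (hmin ⟨h3, h2⟩), (hmax ⟨h3, h2⟩).trans (le_max_right _ _)⟩

theorem sumInv_le (hφ : Admissible φ) {y : ℝ} (hy : 0 < y) : sumInv φ y ≤ y := by
  have := hφ.isProfile_sumInv'.pos y hy
  linarith [hφ.sumInv_add hy]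

theorem sumInv'_le (hφ : Admissible φ) {y : ℝ} (hy : 0 < y) : sumInv' φ y ≤ y := by
  have := hφ.isProfile_sumInv.pos y hy
  linarith [hφ.sumInv_add hy]

/-- With `d = 1 + logDer φ ≥ c` at `sumInv φ y`, `sumInvLog` is `(1 + φ)/(1 + dφ) ≤ 1 + 1/c`, and
`sumInvLog'` is `d` times it. -/
theorem exists_sumInvLog_bound (hφ : Admissible φ) (M : ℝ) :
    ∃ K : ℝ, 0 < K ∧ ∀ y, 0 < y → y ≤ M → sumInvLog φ y ≤ K ∧ sumInvLog' φ y ≤ K := by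
  obtain ⟨c, C, hc, h⟩ := hφ.exists_logDer_bounds M
  refine ⟨(1 + 1 / c) * (1 + |C|), by positivity, fun y hy hyM => ?_⟩
  have hs := hφ.isProfile_sumInv.pos y hy
  obtain ⟨h1, h2⟩ := h _ hs ((hφ.sumInv_le hy).trans hyM)
  have hp := hφ.pos _ hs
  have hl := hφ.sumInvLog_pos hy
  have e : sumInvLog φ y ≤ 1 + 1 / c := by
    rw [sumInvLog, one_div_div]
    generalize 1 + logDer φ (sumInv φ y) = d at *
    have hd : 0 < d := hc.trans_le h1
    rw [div_le_iff₀ (by positivity)]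
    have : φ (sumInv φ y) ≤ 1 / c * (d * φ (sumInv φ y)) := by
      rw [one_div, ← div_eq_inv_mul, le_div_iff₀ hc]
      nlinarith
    have h3 : 0 < 1 / c := by positivity
    nlinarith [mul_pos hd hp]
  have hC : C ≤ 1 + |C| := by linarith [le_abs_self C]
  constructor
  · exact e.trans (le_mul_of_one_le_right (by positivity) (by linarith [abs_nonneg C]))
  · rw [sumInvLog', mul_comm]
    exact mul_le_mul e (h2.trans hC) (hφ.logDer_pos hs).le (by positivity)

end Admissible

/-! ### The sesquilinear form -/

section Algebra

variable (B : Matrix (Fin N) (Fin N) ℂ) (ξ ξ' η η' : Fin N → ℂ) (c : ℂ)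

theorem cinner_eq_dotProduct : cinner ξ η = ξ ⬝ᵥ star η := rfl

theorem cinner_add_left : cinner (ξ + ξ') η = cinner ξ η + cinner ξ' η := add_dotProduct _ _ _

theorem cinner_sub_left : cinner (ξ - ξ') η = cinner ξ η - cinner ξ' η := sub_dotProduct _ _ _

theorem cinner_add_right : cinner ξ (η + η') = cinner ξ η + cinner ξ η' := by
  rw [cinner_eq_dotProduct, star_add, dotProduct_add]
  rfl

theorem cinner_smul_left : cinner (c • ξ) η = c * cinner ξ η := smul_dotProduct _ _ _

theorem cinner_smul_right : cinner ξ (c • η) = star c * cinner ξ η := by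
  rw [cinner_eq_dotProduct, star_smul, dotProduct_smul]
  rfl

@[simp] theorem cinner_zero_right : cinner ξ 0 = 0 := by simp [cinner]

theorem cinner_conjTranspose_mulVec : cinner (Bᴴ *ᵥ ξ) η = star (cinner (B *ᵥ η) ξ) := by
  simp only [cinner_eq_dotProduct]
  rw [← star_dotProduct_star, star_star, star_mulVec, dotProduct_comm, dotProduct_mulVec,
    dotProduct_comm]

theorem re_cinner_conjTranspose_mulVec : (cinner (Bᴴ *ᵥ ξ) η).re = (cinner (B *ᵥ η) ξ).re := by
  rw [cinner_conjTranspose_mulVec]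
  rfl

end Algebra

/-- The components of the vector `w` along `z`. -/
def radVec (z : ℂ) (w : Fin N → ℂ) (i : Fin N) : ℂ := radPart z (w i)

/-- `i` times the components of the vector `w` orthogonal to `z`. -/
def angVec (z : ℂ) (w : Fin N → ℂ) (i : Fin N) : ℂ := Complex.I * angPart z (w i)

@[simp] theorem radVec_zero (w : Fin N → ℂ) : radVec 0 w = 0 := by ext; simp [radVec]

@[simp] theorem angVec_zero (w : Fin N → ℂ) : angVec 0 w = 0 := by ext; simp [angVec]

theorem radVec_add_angVec (z : ℂ) (w : Fin N → ℂ) :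
    radVec z w + angVec z w = star (unitDir z) • w := by
  ext i
  exact (star_unitDir_mul_eq z (w i)).symm

theorem eq_unitDir_smul {z : ℂ} (hz : z ≠ 0) (w : Fin N → ℂ) :
    w = unitDir z • (radVec z w + angVec z w) := by
  ext i
  exact eq_unitDir_mul hz (w i)

theorem radialGrad_vec (f l : ℝ → ℝ) (z : ℂ) (w : Fin N → ℂ) :
    (fun i => radialGrad f l z (w i)) = unitDir z •
      (((l ‖z‖ * (f ‖z‖ / ‖z‖) : ℝ) : ℂ) • radVec z w + ((f ‖z‖ / ‖z‖ : ℝ) : ℂ) • angVec z w) := by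
  ext i
  rfl

/-- The four products of the radial and angular components. -/
def formTerms (B : Matrix (Fin N) (Fin N) ℂ) (z : ℂ) (w : Fin N → ℂ) : Fin 4 → ℂ :=
  ![cinner (B *ᵥ radVec z w) (radVec z w), cinner (B *ᵥ angVec z w) (angVec z w),
    cinner (B *ᵥ radVec z w) (angVec z w), cinner (B *ᵥ angVec z w) (radVec z w)]

@[simp] theorem formTerms_zero (B : Matrix (Fin N) (Fin N) ℂ) (w : Fin N → ℂ) :
    formTerms B 0 w = 0 := by
  ext j
  fin_cases j <;> simp [formTerms]

/-- Combination of the four products with coefficients depending on `|z|`. -/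
def formComb (B : Matrix (Fin N) (Fin N) ℂ) (c : Fin 4 → ℝ → ℝ) (z : ℂ) (w : Fin N → ℂ) : ℂ :=
  ∑ j, (c j ‖z‖ : ℂ) * formTerms B z w j

/-- Coefficients of `⟨A∇(f(|z|)σ), ∇(h(|z|)σ)⟩`, where `σ = z / |z|`. -/
def pairCoef (f l h m : ℝ → ℝ) : Fin 4 → ℝ → ℝ :=
  ![fun s => l s * m s * (f s / s * (h s / s)), fun s => f s / s * (h s / s),
    fun s => l s * (f s / s * (h s / s)), fun s => m s * (f s / s * (h s / s))]

/-- Coefficients of the form with logarithmic factor `L` at `f(|z|)σ`, where `σ = z / |z|`. -/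
def levelCoef (L f l : ℝ → ℝ) : Fin 4 → ℝ → ℝ :=
  ![fun s => (1 - L (f s) ^ 2) * l s ^ 2 * (f s / s) ^ 2, fun s => (f s / s) ^ 2,
    fun s => (1 + L (f s)) * l s * (f s / s) ^ 2, fun s => (1 - L (f s)) * l s * (f s / s) ^ 2]

/-- Both gradients carry the same unimodular factor `unitDir z`, which cancels in the sesquilinear
product. -/
theorem cinner_radialGrad (B : Matrix (Fin N) (Fin N) ℂ) (f l h m : ℝ → ℝ) (z : ℂ)
    (w : Fin N → ℂ) :
    cinner (B *ᵥ fun i => radialGrad f l z (w i)) (fun i => radialGrad h m z (w i)) =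
      formComb B (pairCoef f l h m) z w := by
  by_cases hz : z = 0
  · subst hz
    simp only [formComb, formTerms_zero, Pi.zero_apply, mul_zero, Finset.sum_const_zero,
      radialGrad_zero]
    exact cinner_zero_right _
  · have hu : unitDir z * star (unitDir z) = 1 := unitDir_mul_star hz
    rw [radialGrad_vec, radialGrad_vec, mulVec_smul, cinner_smul_left, cinner_smul_right,
      ← mul_assoc, hu, one_mul]
    simp only [mulVec_add, mulVec_smul, cinner_smul_left, cinner_smul_right,
      cinner_add_left, cinner_add_right, formComb, Fin.sum_univ_four, pairCoef, formTerms]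
    simp only [Matrix.cons_val_zero, Matrix.cons_val_one, Matrix.cons_val, ← starRingEnd_apply,
      Complex.conj_ofReal]
    push_cast
    ring

/-- In the real part, `B*` may be replaced by `B` with the arguments exchanged. The radial-radial
contribution of `B - B*` therefore vanishes, and the mixed products acquire the factors `1 + L` and
`1 - L`. -/
theorem re_form_eq (B : Matrix (Fin N) (Fin N) ℂ) (L : ℝ → ℝ) {z : ℂ} (hz : z ≠ 0)
    (w : Fin N → ℂ) :
    (cinner (B *ᵥ w) w + (L ‖z‖ : ℂ) * cinner ((B - Bᴴ) *ᵥ radVec z w)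
        (((‖z‖ : ℂ)⁻¹ * star z) • w) -
      (L ‖z‖ : ℂ) ^ 2 * cinner (B *ᵥ radVec z w) (radVec z w)).re =
    (formComb B (levelCoef L (fun s => s) (fun _ => 1)) z w).re := by
  have hn : ‖z‖ ≠ 0 := norm_ne_zero_iff.2 hz
  have hu : unitDir z * star (unitDir z) = 1 := unitDir_mul_star hz
  have e1 : cinner (B *ᵥ w) w =
      cinner (B *ᵥ (radVec z w + angVec z w)) (radVec z w + angVec z w) := by
    conv_lhs => rw [eq_unitDir_smul hz w]
    rw [mulVec_smul, cinner_smul_left, cinner_smul_right, ← mul_assoc, hu, one_mul]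
  have e2 : (((‖z‖ : ℂ)⁻¹ * star z) • w) = radVec z w + angVec z w := by
    rw [radVec_add_angVec]
    congr 1
    simp [unitDir, div_eq_inv_mul]
  rw [e1, e2, ← Complex.ofReal_pow]
  have r1 := re_cinner_conjTranspose_mulVec B (radVec z w) (radVec z w)
  have r2 := re_cinner_conjTranspose_mulVec B (radVec z w) (angVec z w)
  simp only [mulVec_add, sub_mulVec, cinner_add_left, cinner_add_right, cinner_sub_left, formComb,
    Fin.sum_univ_four, levelCoef, formTerms, Complex.add_re, Complex.sub_re, Complex.re_ofReal_mul,
    Matrix.cons_val_zero, Matrix.cons_val_one, Matrix.cons_val, r1, r2, div_self hn]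
  ring

theorem unitDir_radialMap {f l : ℝ → ℝ} (hf : IsProfile f l) (z : ℂ) :
    unitDir (radialMap f z) = unitDir z := by
  by_cases hz : z = 0
  · simp [hz]
  · have h1 := hf.pos _ (norm_pos_iff.2 hz)
    have h2 : (f ‖z‖ : ℂ) ≠ 0 := by exact_mod_cast h1.ne'
    rw [unitDir, norm_radialMap hf hz, radialMap_eq]
    field_simp

theorem star_unitDir_mul_radialGrad (f l : ℝ → ℝ) (z w : ℂ) :
    star (unitDir z) * radialGrad f l z w =
      ((l ‖z‖ * (f ‖z‖ / ‖z‖) * radPart z w : ℝ) : ℂ) +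
        ((f ‖z‖ / ‖z‖ * angPart z w : ℝ) : ℂ) * Complex.I := by
  by_cases hz : z = 0
  · simp [hz]
  · rw [radialGrad, ← mul_assoc, star_unitDir_mul hz]
    push_cast
    ring

theorem radPart_radialGrad {f l : ℝ → ℝ} (hf : IsProfile f l) (z w : ℂ) :
    radPart (radialMap f z) (radialGrad f l z w) = l ‖z‖ * (f ‖z‖ / ‖z‖) * radPart z w := by
  rw [radPart, unitDir_radialMap hf, star_unitDir_mul_radialGrad]
  simp

theorem angPart_radialGrad {f l : ℝ → ℝ} (hf : IsProfile f l) (z w : ℂ) :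
    angPart (radialMap f z) (radialGrad f l z w) = f ‖z‖ / ‖z‖ * angPart z w := by
  rw [angPart, unitDir_radialMap hf, star_unitDir_mul_radialGrad]
  simp

/-- The map `radialMap f` keeps the direction, multiplies the angular part by `f/s` and the radial
part by `l f/s`; the form at the image is thus rewritten in terms of the original function. -/
theorem formComb_radialMap (B : Matrix (Fin N) (Fin N) ℂ) (L : ℝ → ℝ) {f l : ℝ → ℝ}
    (hf : IsProfile f l) (z : ℂ) (w : Fin N → ℂ) :
    formComb B (levelCoef L (fun s => s) (fun _ => 1)) (radialMap f z)
        (fun i => radialGrad f l z (w i)) = formComb B (levelCoef L f l) z w := by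
  by_cases hz : z = 0
  · simp [formComb, hz]
  have hn : 0 < ‖z‖ := norm_pos_iff.2 hz
  have hfn := (hf.pos _ hn).ne'
  have ea : radVec (radialMap f z) (fun i => radialGrad f l z (w i)) =
      ((l ‖z‖ * (f ‖z‖ / ‖z‖) : ℝ) : ℂ) • radVec z w := by
    ext i
    simp only [radVec, radPart_radialGrad hf, Pi.smul_apply, smul_eq_mul, Complex.ofReal_mul]
  have eb : angVec (radialMap f z) (fun i => radialGrad f l z (w i)) =
      ((f ‖z‖ / ‖z‖ : ℝ) : ℂ) • angVec z w := by
    ext i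
    simp only [angVec, angPart_radialGrad hf, Pi.smul_apply, smul_eq_mul, Complex.ofReal_mul]
    ring
  simp only [formComb, formTerms, ea, eb, Fin.sum_univ_four, levelCoef, mulVec_smul,
    cinner_smul_left, cinner_smul_right, norm_radialMap hf hz]
  simp only [Matrix.cons_val_zero, Matrix.cons_val_one, Matrix.cons_val, ← starRingEnd_apply,
      Complex.conj_ofReal, div_self hfn]
  push_cast
  ring

/-! ### Integrability and limits of the form -/

theorem aestronglyMeasurable_unitDir {v : Space N → ℂ} {μ : Measure (Space N)}
    (hv : AEStronglyMeasurable v μ) : AEStronglyMeasurable (fun x => unitDir (v x)) μ := by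
  have hm : Measurable unitDir :=
    measurable_id.div (Complex.measurable_ofReal.comp measurable_norm)
  exact (hm.comp_aemeasurable hv.aemeasurable).aestronglyMeasurable

theorem HasH10Grad.aestronglyMeasurable_star_mul {v : Space N → ℂ} {g : Space N → Fin N → ℂ}
    (h : HasH10Grad Ω v g) (i : Fin N) :
    AEStronglyMeasurable (fun x => star (unitDir (v x)) * g x i) (domVol Ω) :=
  (continuous_star.comp_aestronglyMeasurable
    (aestronglyMeasurable_unitDir h.1.aestronglyMeasurable)).mul (h.2.1 i).aestronglyMeasurable

theorem HasH10Grad.memLp_radVec {v : Space N → ℂ} {g : Space N → Fin N → ℂ}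
    (h : HasH10Grad Ω v g) (i : Fin N) :
    MemLp (fun x => radVec (v x) (g x) i) 2 (domVol Ω) := by
  refine (h.2.1 i).of_le ((Complex.continuous_ofReal.comp
    Complex.continuous_re).comp_aestronglyMeasurable (h.aestronglyMeasurable_star_mul i))
    (Eventually.of_forall fun x => ?_)
  rw [radVec, Complex.norm_real]
  exact abs_radPart_le _ _

theorem HasH10Grad.memLp_angVec {v : Space N → ℂ} {g : Space N → Fin N → ℂ}
    (h : HasH10Grad Ω v g) (i : Fin N) :
    MemLp (fun x => angVec (v x) (g x) i) 2 (domVol Ω) := by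
  refine (h.2.1 i).of_le (((Complex.continuous_ofReal.comp
    Complex.continuous_im).comp_aestronglyMeasurable (h.aestronglyMeasurable_star_mul i)).const_mul
    Complex.I) (Eventually.of_forall fun x => ?_)
  rw [angVec, norm_mul, Complex.norm_I, one_mul, Complex.norm_real]
  exact abs_angPart_le _ _

theorem integrable_cinner_mulVec {A : Space N → Matrix (Fin N) (Fin N) ℂ}
    (hA : BoundedCoefficients Ω A) {X Y : Space N → Fin N → ℂ}
    (hX : ∀ i, MemLp (fun x => X x i) 2 (domVol Ω))
    (hY : ∀ i, MemLp (fun x => Y x i) 2 (domVol Ω)) :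
    Integrable (fun x => cinner (A x *ᵥ X x) (Y x)) (domVol Ω) := by
  simp only [cinner, mulVec, dotProduct, Finset.sum_mul]
  refine integrable_finsetSum _ fun i _ => integrable_finsetSum _ fun j _ => ?_
  have h1 : Integrable (fun x => X x j * star (Y x i)) (domVol Ω) :=
    (hX j).integrable_mul (hY i).star
  have h2 : Integrable (fun x => A x i j * (X x j * star (Y x i))) (domVol Ω) :=
    (hA i j).integrable_mul (memLp_one_iff_integrable.2 h1)
  simpa only [mul_assoc] using h2

theorem HasH10Grad.integrable_formTerms {v : Space N → ℂ} {g : Space N → Fin N → ℂ}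
    (h : HasH10Grad Ω v g) {A : Space N → Matrix (Fin N) (Fin N) ℂ}
    (hA : BoundedCoefficients Ω A) (j : Fin 4) :
    Integrable (fun x => formTerms (A x) (v x) (g x) j) (domVol Ω) := by
  fin_cases j
  · exact integrable_cinner_mulVec hA h.memLp_radVec h.memLp_radVec
  · exact integrable_cinner_mulVec hA h.memLp_angVec h.memLp_angVec
  · exact integrable_cinner_mulVec hA h.memLp_radVec h.memLp_angVec
  · exact integrable_cinner_mulVec hA h.memLp_angVec h.memLp_radVec

theorem integrable_coef_mul {v F : Space N → ℂ} {c : ℝ → ℝ} {K : ℝ}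
    (hv : AEStronglyMeasurable v (domVol Ω)) (hF : Integrable F (domVol Ω))
    (h0 : ∀ x, v x = 0 → F x = 0) (hc : ContinuousOn c (Ioi 0)) (hK : ∀ s, 0 < s → |c s| ≤ K) :
    Integrable (fun x => (c ‖v x‖ : ℂ) * F x) (domVol Ω) := by
  -- Nothing is known of `c` outside `(0, ∞)`. Cutting it off there restores measurability and
  -- changes nothing, because `F` vanishes where `v` does.
  have hm : Measurable ((Ioi (0 : ℝ)).indicator c) := by
    classical
    rw [← piecewise_eq_indicator]
    exact hc.measurable_piecewise continuousOn_const measurableSet_Ioi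
  have hK0 : 0 ≤ K := (abs_nonneg _).trans (hK 1 one_pos)
  have h1 : Integrable (fun x => (((Ioi (0 : ℝ)).indicator c ‖v x‖ : ℝ) : ℂ) * F x)
      (domVol Ω) := by
    refine hF.bdd_mul (c := K) ?_ (Eventually.of_forall fun x => ?_)
    · exact (Complex.measurable_ofReal.comp_aemeasurable
        (hm.comp_aemeasurable hv.norm.aemeasurable)).aestronglyMeasurable
    · rw [Complex.norm_real, Real.norm_eq_abs]
      by_cases hx : ‖v x‖ ∈ Ioi (0 : ℝ)
      · rw [indicator_of_mem hx]; exact hK _ hx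
      · rw [indicator_of_notMem hx, abs_zero]; exact hK0
  refine h1.congr (Eventually.of_forall fun x => ?_)
  by_cases hx : v x = 0
  · simp [h0 x hx]
  · simp [indicator_of_mem (show ‖v x‖ ∈ Ioi (0 : ℝ) from norm_pos_iff.2 hx)]

theorem HasH10Grad.integrable_coef_mul_formTerms {v : Space N → ℂ} {g : Space N → Fin N → ℂ}
    (h : HasH10Grad Ω v g) {A : Space N → Matrix (Fin N) (Fin N) ℂ}
    (hA : BoundedCoefficients Ω A) {c : ℝ → ℝ} (hc : ContinuousOn c (Ioi 0)) {K : ℝ}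
    (hK : ∀ s, 0 < s → |c s| ≤ K) (j : Fin 4) :
    Integrable (fun x => (c ‖v x‖ : ℂ) * formTerms (A x) (v x) (g x) j) (domVol Ω) :=
  integrable_coef_mul h.1.aestronglyMeasurable (h.integrable_formTerms hA j)
    (fun x hx => by rw [hx, formTerms_zero]; rfl) hc hK

theorem HasH10Grad.integrable_formComb {v : Space N → ℂ} {g : Space N → Fin N → ℂ}
    (h : HasH10Grad Ω v g) {A : Space N → Matrix (Fin N) (Fin N) ℂ}
    (hA : BoundedCoefficients Ω A) {c : Fin 4 → ℝ → ℝ} (hc : ∀ j, ContinuousOn (c j) (Ioi 0))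
    {K : ℝ} (hK : ∀ j s, 0 < s → |c j s| ≤ K) :
    Integrable (fun x => formComb (A x) c (v x) (g x)) (domVol Ω) :=
  integrable_finsetSum _ fun j _ => h.integrable_coef_mul_formTerms hA (hc j) (hK j) j

/-- The function and its gradient stay fixed and only the coefficients vary; hence uniform
boundedness and pointwise convergence on `(0, ∞)` are enough. -/
theorem HasH10Grad.integral_formComb_nonneg_of_tendsto {v : Space N → ℂ}
    {g : Space N → Fin N → ℂ} (h : HasH10Grad Ω v g) {A : Space N → Matrix (Fin N) (Fin N) ℂ}
    (hA : BoundedCoefficients Ω A) {cn : ℕ → Fin 4 → ℝ → ℝ} {c : Fin 4 → ℝ → ℝ}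
    (hcn : ∀ n j, ContinuousOn (cn n j) (Ioi 0)) {K : ℝ}
    (hK : ∀ n j s, 0 < s → |cn n j s| ≤ K)
    (hlim : ∀ j s, 0 < s → Tendsto (fun n => cn n j s) atTop (𝓝 (c j s)))
    (hnn : ∀ n, 0 ≤ (∫ x in (Ω : Set (Space N)), formComb (A x) (cn n) (v x) (g x)).re) :
    0 ≤ (∫ x in (Ω : Set (Space N)), formComb (A x) c (v x) (g x)).re := by
  have ht : Tendsto (fun n => ∫ x in (Ω : Set (Space N)), formComb (A x) (cn n) (v x) (g x))
      atTop (𝓝 (∫ x in (Ω : Set (Space N)), formComb (A x) c (v x) (g x))) := by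
    refine tendsto_integral_of_dominated_convergence
      (fun x => ∑ j, K * ‖formTerms (A x) (v x) (g x) j‖)
      (fun n => (h.integrable_formComb hA (hcn n) (hK n)).aestronglyMeasurable)
      (integrable_finsetSum _ fun j _ => (h.integrable_formTerms hA j).norm.const_mul K)
      (fun n => Eventually.of_forall fun x => ?_) (Eventually.of_forall fun x => ?_)
    · refine (norm_sum_le _ _).trans (Finset.sum_le_sum fun j _ => ?_)
      by_cases hx : v x = 0
      · simp [hx]
      · rw [norm_mul, Complex.norm_real]
        exact mul_le_mul_of_nonneg_right (hK n j _ (norm_pos_iff.2 hx)) (norm_nonneg _)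
    · by_cases hx : v x = 0
      · simp [formComb, hx]
      · exact tendsto_finsetSum _ fun j _ => ((Complex.continuous_ofReal.tendsto _).comp
          (hlim j _ (norm_pos_iff.2 hx))).mul_const _
  exact ge_of_tendsto' ((Complex.continuous_re.tendsto _).comp ht) hnn

theorem BoundedCoefficients.sub_conjTranspose {A : Space N → Matrix (Fin N) (Fin N) ℂ}
    (hA : BoundedCoefficients Ω A) : BoundedCoefficients Ω (fun x => A x - (A x)ᴴ) :=
  fun i j => (hA i j).sub (hA j i).star

/-- The two integrands agree only in their real parts, so both must be shown integrable before the
real part is taken inside the integrals. -/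
theorem HasH10Grad.re_integral_formIntegrand {v : Space N → ℂ} {g : Space N → Fin N → ℂ}
    (h : HasH10Grad Ω v g) {A : Space N → Matrix (Fin N) (Fin N) ℂ}
    (hA : BoundedCoefficients Ω A) {φ : ℝ → ℝ} (hφ : Admissible φ) :
    (∫ x in (Ω : Set (Space N)), formIntegrand Ω A φ v x).re =
      (∫ x in (Ω : Set (Space N)),
        formComb (A x) (levelCoef (Lambda φ) (fun s => s) (fun _ => 1)) (v x) (g x)).re := by
  have hmod := h.modulus.weakGrad_ae_eq
  have hw := h.weakGrad_ae_eq
  have hL := hφ.continuousOn_Lambda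
  have hLb : ∀ s, 0 < s → |Lambda φ s| ≤ 1 := fun s hs => hφ.abs_Lambda_le hs
  have hLb2 : ∀ s, 0 < s → |Lambda φ s ^ 2| ≤ 1 := fun s hs => by
    rw [abs_pow]; exact pow_le_one₀ (abs_nonneg _) (hLb s hs)
  have hint2 : Integrable (fun x => formComb (A x)
      (levelCoef (Lambda φ) (fun s => s) (fun _ => 1)) (v x) (g x)) (domVol Ω) := by
    refine h.integrable_formComb hA (K := 2) (fun j => ?_) fun j s hs => ?_
    · have hq : ContinuousOn (fun s : ℝ => (s / s) ^ 2) (Ioi 0) :=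
        (continuousOn_id.div continuousOn_id fun s hs => (ne_of_gt hs)).pow 2
      fin_cases j
      · exact ((continuousOn_const.sub (hL.pow 2)).mul continuousOn_const).mul hq
      · exact hq
      · exact ((continuousOn_const.add hL).mul continuousOn_const).mul hq
      · exact ((continuousOn_const.sub hL).mul continuousOn_const).mul hq
    · have h1 := abs_le.1 (hLb s hs)
      have h2 := abs_le.1 (hLb2 s hs)
      rw [abs_le]
      fin_cases j <;> simp [levelCoef, hs.ne'] <;> first | (constructor <;> linarith) | norm_num
  have hint1 : Integrable (formIntegrand Ω A φ v) (domVol Ω) := by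
    have i1 := integrable_cinner_mulVec hA h.2.1 h.2.1
    have i2 : Integrable (fun x => (Lambda φ ‖v x‖ : ℂ) *
        cinner ((A x - (A x)ᴴ) *ᵥ radVec (v x) (g x)) (radVec (v x) (g x) + angVec (v x) (g x)))
        (domVol Ω) :=
      integrable_coef_mul h.1.aestronglyMeasurable
        (integrable_cinner_mulVec hA.sub_conjTranspose h.memLp_radVec
          fun i => (h.memLp_radVec i).add (h.memLp_angVec i))
        (fun x hx => by simp [hx]) hL hLb
    have i3 : Integrable (fun x => ((Lambda φ ‖v x‖ ^ 2 : ℝ) : ℂ) *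
        cinner (A x *ᵥ radVec (v x) (g x)) (radVec (v x) (g x))) (domVol Ω) :=
      integrable_coef_mul (c := fun s => Lambda φ s ^ 2) h.1.aestronglyMeasurable
        (integrable_cinner_mulVec hA h.memLp_radVec h.memLp_radVec)
        (fun x hx => by simp [hx]) (hL.pow 2) hLb2
    refine ((i1.add i2).sub i3).congr ?_
    filter_upwards [hmod, hw, h.ae_eq_zero] with x h1 h2 h3
    rw [formIntegrand]
    split_ifs with h0
    · simp [h3 h0, h0]
    · have e2 : (((‖v x‖ : ℂ)⁻¹ * star (v x)) • g x) =
          radVec (v x) (g x) + angVec (v x) (g x) := by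
        rw [radVec_add_angVec]
        congr 1
        simp [unitDir, div_eq_inv_mul]
      rw [h1, h2, e2, ← Complex.ofReal_pow]
      rfl
  have key : ∫ x in (Ω : Set (Space N)), (formIntegrand Ω A φ v x).re =
      ∫ x in (Ω : Set (Space N)), (formComb (A x)
        (levelCoef (Lambda φ) (fun s => s) (fun _ => 1)) (v x) (g x)).re := by
    refine integral_congr_ae ?_
    filter_upwards [hmod, hw] with x h1 h2
    rw [formIntegrand]
    split_ifs with h0
    · simp [formComb, h0]
    · rw [h1, h2]
      exact re_form_eq (A x) (Lambda φ) h0 (g x)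
  exact (integral_re hint1).symm.trans (key.trans (integral_re hint2))

theorem HasH10Grad.integral_cinner_radialMap {v : Space N → ℂ} {g : Space N → Fin N → ℂ}
    {f l k m : ℝ → ℝ} (A : Space N → Matrix (Fin N) (Fin N) ℂ)
    (h : HasH10Grad Ω (fun x => radialMap f (v x)) (fun x i => radialGrad f l (v x) (g x i)))
    (h' : HasH10Grad Ω (fun x => radialMap k (v x)) (fun x i => radialGrad k m (v x) (g x i))) :
    ∫ x in (Ω : Set (Space N)), cinner (A x *ᵥ weakGrad Ω (fun x => radialMap f (v x)) x)
        (weakGrad Ω (fun x => radialMap k (v x)) x) =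
      ∫ x in (Ω : Set (Space N)), formComb (A x) (pairCoef f l k m) (v x) (g x) := by
  refine integral_congr_ae ?_
  filter_upwards [h.weakGrad_ae_eq, h'.weakGrad_ae_eq] with x h1 h2
  rw [h1, h2]
  exact cinner_radialGrad (A x) f l k m (v x) (g x)

theorem re_integral_formIntegrand_radialMap {v : Space N → ℂ} {g : Space N → Fin N → ℂ}
    {f l : ℝ → ℝ} {A : Space N → Matrix (Fin N) (Fin N) ℂ} (hA : BoundedCoefficients Ω A)
    {φ : ℝ → ℝ} (hφ : Admissible φ) (hf : IsProfile f l)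
    (h : HasH10Grad Ω (fun x => radialMap f (v x)) (fun x i => radialGrad f l (v x) (g x i))) :
    (∫ x in (Ω : Set (Space N)), formIntegrand Ω A φ (fun x => radialMap f (v x)) x).re =
      (∫ x in (Ω : Set (Space N)),
        formComb (A x) (levelCoef (Lambda φ) f l) (v x) (g x)).re := by
  rw [h.re_integral_formIntegrand hA hφ]
  simp_rw [formComb_radialMap _ _ hf]

/-! ### Comparison of the two forms -/

theorem formComb_congr (B : Matrix (Fin N) (Fin N) ℂ) {c c' : Fin 4 → ℝ → ℝ}
    (h : ∀ j s, 0 < s → c j s = c' j s) (z : ℂ) (w : Fin N → ℂ) :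
    formComb B c z w = formComb B c' z w := by
  by_cases hz : z = 0
  · simp [formComb, hz]
  · simp_rw [formComb, h _ _ (norm_pos_iff.2 hz)]

/-- The algebraic core: `T² = PR` together with the relations `l_P = (1 + L) l_T`, `l_R = (1 - L)
l_T` makes the coefficients of the two forms coincide. -/
theorem levelCoef_eq_pairCoef {L f l P lP R lR : ℝ → ℝ} {s : ℝ} (hT : f s ^ 2 = P s * R s)
    (h1 : (1 + L (f s)) * l s = lP s) (h2 : (1 - L (f s)) * l s = lR s) (j : Fin 4) :
    levelCoef L f l j s = pairCoef P lP R lR j s := by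
  have hq : (f s / s) ^ 2 = P s / s * (R s / s) := by
    rw [div_pow, hT, div_mul_div_comm, sq]
  fin_cases j
  · simp only [levelCoef, pairCoef, Fin.zero_eta, Matrix.cons_val_zero, hq, ← h1, ← h2]
    ring
  · simpa [levelCoef, pairCoef] using hq
  · simp only [levelCoef, pairCoef, Fin.reduceFinMk, Matrix.cons_val, hq, ← h1]
  · simp only [levelCoef, pairCoef, Fin.reduceFinMk, Matrix.cons_val, hq, ← h2]

theorem tendsto_pairCoef {fn ln hn mn : ℕ → ℝ → ℝ} {f l h m : ℝ → ℝ} {s : ℝ}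
    (h1 : Tendsto (fun n => fn n s) atTop (𝓝 (f s)))
    (h2 : Tendsto (fun n => ln n s) atTop (𝓝 (l s)))
    (h3 : Tendsto (fun n => hn n s) atTop (𝓝 (h s)))
    (h4 : Tendsto (fun n => mn n s) atTop (𝓝 (m s))) (j : Fin 4) :
    Tendsto (fun n => pairCoef (fn n) (ln n) (hn n) (mn n) j s) atTop
      (𝓝 (pairCoef f l h m j s)) := by
  have hb := (h1.div_const s).mul (h3.div_const s)
  fin_cases j
  · exact (h2.mul h4).mul hb
  · exact hb
  · exact h2.mul hb
  · exact h4.mul hb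

theorem continuousOn_pairCoef {f l h m : ℝ → ℝ} (hf : IsProfile f l) (hh : IsProfile h m)
    (j : Fin 4) : ContinuousOn (pairCoef f l h m j) (Ioi 0) := by
  have hb : ContinuousOn (fun s => f s / s * (h s / s)) (Ioi 0) :=
    (hf.continuousOn_left.div continuousOn_id fun s hs => ne_of_gt hs).mul
      (hh.continuousOn_left.div continuousOn_id fun s hs => ne_of_gt hs)
  fin_cases j
  · exact (hf.continuousOn.mul hh.continuousOn).mul hb
  · exact hb
  · exact hf.continuousOn.mul hb
  · exact hh.continuousOn.mul hb

theorem IsProfile.logDeriv_unique {f l k m : ℝ → ℝ} (hf : IsProfile f l) (hk : IsProfile k m)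
    (h : ∀ s, 0 < s → f s = k s) {s : ℝ} (hs : 0 < s) : l s = m s := by
  have h1 := (hk.hasDerivAt s hs).congr_of_eventuallyEq
    (show f =ᶠ[𝓝 s] k by filter_upwards [Ioi_mem_nhds hs] with y hy using h y hy)
  have h2 := (hf.hasDerivAt s hs).unique h1
  have h3 := hk.pos s hs
  rw [h s hs] at h2
  field_simp at h2
  exact h2

/-! ### The modulus of `v` as a function of the modulus of `u + φ(|u|)u`. -/

namespace Admissible

variable {φ : ℝ → ℝ}

/-- The geometric mean of `sumInv φ` and `sumInv' φ`. -/
def sumMean (φ : ℝ → ℝ) (y : ℝ) : ℝ := sumInv φ y * √(φ (sumInv φ y))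

/-- The logarithmic derivative of `sumMean φ`. -/
def sumMeanLog (φ : ℝ → ℝ) (y : ℝ) : ℝ := (1 + logDer φ (sumInv φ y) / 2) * sumInvLog φ y

theorem isProfile_sumMean (hφ : Admissible φ) : IsProfile (sumMean φ) (sumMeanLog φ) :=
  hφ.isProfile_mul_sqrt.comp hφ.isProfile_sumInv

theorem sumMean_sq (hφ : Admissible φ) {y : ℝ} (hy : 0 < y) :
    sumMean φ y ^ 2 = sumInv φ y * sumInv' φ y :=
  hφ.mul_sqrt_sq (hφ.isProfile_sumInv.pos y hy)

/-- Chain rule for `sumInv = ζ ∘ sumMean`, since `1 + Λ` is the logarithmic derivative of `ζ`. -/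
theorem one_add_Lambda_mul (hφ : Admissible φ) {y : ℝ} (hy : 0 < y) :
    (1 + Lambda φ (sumMean φ y)) * sumMeanLog φ y = sumInvLog φ y := by
  have hs := hφ.isProfile_sumInv.pos y hy
  have hz : zeta φ (sumMean φ y) = sumInv φ y := hφ.zeta_apply hs
  rw [hφ.one_add_Lambda (hφ.isProfile_sumMean.pos y hy), hz, sumMeanLog]
  have : 1 + logDer φ (sumInv φ y) / 2 ≠ 0 := by linarith [hφ.logDer_half_pos hs]
  rw [one_div, inv_mul_cancel_left₀ this]

/-- The relation `sumMean² = sumInv · sumInv'` makes the two logarithmic derivatives add up to `2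
sumMeanLog`. -/
theorem one_sub_Lambda_mul (hφ : Admissible φ) {y : ℝ} (hy : 0 < y) :
    (1 - Lambda φ (sumMean φ y)) * sumMeanLog φ y = sumInvLog' φ y := by
  have h := hφ.one_add_Lambda_mul hy
  have h2 : (1 - Lambda φ (sumMean φ y)) * sumMeanLog φ y = 2 * sumMeanLog φ y -
      (1 + Lambda φ (sumMean φ y)) * sumMeanLog φ y := by ring
  rw [h2, h, sumMeanLog, sumInvLog']
  ring

theorem levelCoef_comp (hφ : Admissible φ) {k κ : ℝ → ℝ} (hk : IsProfile k κ) (j : Fin 4) {s : ℝ}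
    (hs : 0 < s) :
    levelCoef (Lambda φ) (fun s => sumMean φ (k s)) (fun s => sumMeanLog φ (k s) * κ s) j s =
      pairCoef (fun s => sumInv φ (k s)) (fun s => sumInvLog φ (k s) * κ s)
        (fun s => sumInv' φ (k s)) (fun s => sumInvLog' φ (k s) * κ s) j s := by
  have hks := hk.pos s hs
  refine levelCoef_eq_pairCoef ?_ ?_ ?_ j
  · exact hφ.sumMean_sq hks
  · simp only [← mul_assoc, hφ.one_add_Lambda_mul hks]
  · simp only [← mul_assoc, hφ.one_sub_Lambda_mul hks]

theorem sumMean_le (hφ : Admissible φ) {y : ℝ} (hy : 0 < y) : sumMean φ y ≤ y := by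
  refine abs_le_of_sq_le_sq' ?_ hy.le |>.2
  rw [hφ.sumMean_sq hy, sq]
  exact mul_le_mul (hφ.sumInv_le hy) (hφ.sumInv'_le hy) (hφ.isProfile_sumInv'.pos y hy).le hy.le

theorem sumMeanLog_pos (hφ : Admissible φ) {y : ℝ} (hy : 0 < y) : 0 < sumMeanLog φ y :=
  mul_pos (by linarith [hφ.logDer_half_pos (hφ.isProfile_sumInv.pos y hy)]) (hφ.sumInvLog_pos hy)

theorem two_mul_sumMeanLog (φ : ℝ → ℝ) (y : ℝ) :
    2 * sumMeanLog φ y = sumInvLog φ y + sumInvLog' φ y := by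
  rw [sumMeanLog, sumInvLog']
  ring

end Admissible

open Admissible

theorem softMin_log_nonneg {c s : ℝ} (hc : 0 < c) (hs : 0 < s) : 0 ≤ c / (s + c) := by positivity

theorem softMin_log_le_one {c s : ℝ} (hc : 0 < c) (hs : 0 < s) : c / (s + c) ≤ 1 :=
  (div_le_one (by positivity)).2 (by linarith)

/-! ### Sufficiency: from the form to dissipativity. -/

theorem lPhiDissipative_of_formIntegrand_nonneg {A : Space N → Matrix (Fin N) (Fin N) ℂ}
    (hA : BoundedCoefficients Ω A) {φ : ℝ → ℝ} (hφ : Admissible φ)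
    (H : ∀ v : Space N → ℂ, MemH10 Ω v →
      0 ≤ (∫ x in (Ω : Set (Space N)), formIntegrand Ω A φ v x).re) :
    LPhiDissipative Ω A φ := by
  intro u hu hw
  -- The sum of `u` and `φ(|u|)u` is the variable in which both are 1-Lipschitz radial images.
  have hz := hu.hasH10Grad.add hw.hasH10Grad
  set z : Space N → ℂ := fun x => u x + phiMul φ u x with hzdef
  set g : Space N → Fin N → ℂ := fun x i => weakGrad Ω u x i + weakGrad Ω (phiMul φ u) x i
  have hp := hφ.isProfile_sumInv
  have hq := hφ.isProfile_sumInv'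
  have hpq : ∀ x, u x = radialMap (sumInv φ) (z x) ∧
      phiMul φ u x = radialMap (sumInv' φ) (z x) := by
    intro x
    by_cases h0 : u x = 0
    · simp [hzdef, phiMul, h0]
    have hn : 0 < ‖u x‖ := norm_pos_iff.2 h0
    have hpos := hφ.pos _ hn
    have hzx : z x = ((1 + φ ‖u x‖ : ℝ) : ℂ) * u x := by
      simp only [hzdef, phiMul]
      push_cast
      ring
    have hnz : ‖z x‖ = ‖u x‖ + ‖u x‖ * φ ‖u x‖ := by
      rw [hzx, norm_mul, Complex.norm_real, Real.norm_of_nonneg (by positivity)]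
      ring
    have e := hφ.sumInv_apply hn
    have h1 : (‖u x‖ : ℂ) ≠ 0 := by exact_mod_cast hn.ne'
    have h2 : (1 : ℂ) + (φ ‖u x‖ : ℂ) ≠ 0 := by
      have : (1 : ℝ) + φ ‖u x‖ ≠ 0 := by positivity
      exact_mod_cast this
    constructor
    · rw [radialMap, hnz, e, hzx]
      push_cast
      field_simp
    · rw [radialMap, hnz, sumInv', e, hzx, phiMul]
      push_cast
      field_simp
  have hu' : u = fun x => radialMap (sumInv φ) (z x) := funext fun x => (hpq x).1
  have hw' : phiMul φ u = fun x => radialMap (sumInv' φ) (z x) := funext fun x => (hpq x).2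
  have Hp := hz.radial hp (K := 1)
    (fun s hs => (div_le_one hs).2 (hφ.sumInv_le hs)) (fun s hs => by
      rw [mul_div_assoc', abs_of_nonneg (div_nonneg (mul_pos (hφ.sumInvLog_pos hs)
        (hp.pos s hs)).le hs.le)]
      exact (div_le_one hs).2 (hφ.sumInvLog_mul_le hs))
  have Hq := hz.radial hq (K := 1)
    (fun s hs => (div_le_one hs).2 (hφ.sumInv'_le hs)) (fun s hs => by
      rw [mul_div_assoc', abs_of_nonneg (div_nonneg (mul_pos (hφ.sumInvLog'_pos hs)
        (hq.pos s hs)).le hs.le)]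
      exact (div_le_one hs).2 (hφ.sumInvLog'_mul_le hs))
  have key := HasH10Grad.integral_cinner_radialMap A Hp Hq
  rw [← hu', ← hw'] at key
  rw [key]
  have hc : ∀ n : ℕ, (0 : ℝ) < (n : ℝ) + 1 := fun n => by positivity
  have hk := fun n : ℕ => isProfile_softMin (hc n)
  refine hz.integral_formComb_nonneg_of_tendsto hA (K := 1)
    (cn := fun n => pairCoef (fun s => sumInv φ (softMin ((n : ℝ) + 1) s))
      (fun s => sumInvLog φ (softMin ((n : ℝ) + 1) s) * (((n : ℝ) + 1) / (s + ((n : ℝ) + 1))))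
      (fun s => sumInv' φ (softMin ((n : ℝ) + 1) s))
      (fun s => sumInvLog' φ (softMin ((n : ℝ) + 1) s) * (((n : ℝ) + 1) / (s + ((n : ℝ) + 1)))))
    (fun n => continuousOn_pairCoef (hp.comp (hk n)) (hq.comp (hk n))) ?_ ?_ ?_
  -- The bound 1 is uniform in `n`: truncation keeps `y ≤ s` with logarithmic derivative `d ≤ 1`,
  -- and `sumInv`, `sumInv'` and their products with their logarithmic derivatives are at most `y`.
  · intro n j s hs
    have hy := (hk n).pos s hs
    have hys := softMin_le_left (hc n) hs
    have l1 := softMin_log_le_one (hc n) hs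
    have l0 := softMin_log_nonneg (hc n) hs
    set y := softMin ((n : ℝ) + 1) s
    set d := ((n : ℝ) + 1) / (s + ((n : ℝ) + 1))
    have a0 : 0 ≤ sumInv φ y / s := (div_pos (hp.pos y hy) hs).le
    have b0 : 0 ≤ sumInv' φ y / s := (div_pos (hq.pos y hy) hs).le
    have a1 : sumInv φ y / s ≤ 1 := (div_le_one hs).2 ((hφ.sumInv_le hy).trans hys)
    have b1 : sumInv' φ y / s ≤ 1 := (div_le_one hs).2 ((hφ.sumInv'_le hy).trans hys)
    have a2 : 0 ≤ sumInvLog φ y * d * (sumInv φ y / s) :=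
      mul_nonneg (mul_nonneg (hφ.sumInvLog_pos hy).le l0) a0
    have b2 : 0 ≤ sumInvLog' φ y * d * (sumInv' φ y / s) :=
      mul_nonneg (mul_nonneg (hφ.sumInvLog'_pos hy).le l0) b0
    have a3 : sumInvLog φ y * d * (sumInv φ y / s) ≤ 1 := by
      have e : sumInvLog φ y * d * (sumInv φ y / s) = d * (sumInvLog φ y * sumInv φ y / s) := by
        ring
      rw [e]
      exact mul_le_one₀ l1 (div_nonneg (mul_pos (hφ.sumInvLog_pos hy) (hp.pos y hy)).le hs.le)
        ((div_le_one hs).2 ((hφ.sumInvLog_mul_le hy).trans hys))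
    have b3 : sumInvLog' φ y * d * (sumInv' φ y / s) ≤ 1 := by
      have e : sumInvLog' φ y * d * (sumInv' φ y / s) =
        d * (sumInvLog' φ y * sumInv' φ y / s) := by ring
      rw [e]
      exact mul_le_one₀ l1 (div_nonneg (mul_pos (hφ.sumInvLog'_pos hy) (hq.pos y hy)).le hs.le)
        ((div_le_one hs).2 ((hφ.sumInvLog'_mul_le hy).trans hys))
    have hab : ∀ a b : ℝ, 0 ≤ a → 0 ≤ b → a ≤ 1 → b ≤ 1 → |a * b| ≤ 1 := fun a b ha hb ha' hb' => by
      rw [abs_of_nonneg (mul_nonneg ha hb)]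
      exact mul_le_one₀ ha' hb hb'
    fin_cases j
    · refine le_trans (le_of_eq ?_) (hab _ _ a2 b2 a3 b3)
      simp only [pairCoef, Fin.zero_eta, Matrix.cons_val_zero]
      congr 1
      ring
    · exact hab _ _ a0 b0 a1 b1
    · refine le_trans (le_of_eq ?_) (hab _ _ a2 b0 a3 b1)
      simp only [pairCoef, Fin.reduceFinMk, Matrix.cons_val]
      congr 1
      ring
    · refine le_trans (le_of_eq ?_) (hab _ _ a0 b2 a1 b3)
      simp only [pairCoef, Fin.reduceFinMk, Matrix.cons_val]
      congr 1
      ring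
  · intro j s hs
    have t1 := tendsto_softMin s
    have t2 := tendsto_div_add_nat s
    refine tendsto_pairCoef ?_ ?_ ?_ ?_ j
    · exact (hp.continuousAt_left hs).tendsto.comp t1
    · simpa using ((hp.continuousAt hs).tendsto.comp t1).mul t2
    · exact (hq.continuousAt_left hs).tendsto.comp t1
    · simpa using ((hq.continuousAt hs).tendsto.comp t1).mul t2
  -- For fixed `n` the truncated modulus is at most `n + 1`, so the logarithmic derivatives are
  -- bounded and the radial map with profile `sumMean` of the truncated modulus sends `z` into
  -- `H̊¹`; there the hypothesis applies.
  · intro n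
    obtain ⟨K, hK0, hK⟩ := hφ.exists_sumInvLog_bound ((n : ℝ) + 1)
    have hT := hφ.isProfile_sumMean.comp (hk n)
    have HT := hz.radial hT (K := 1 + K) (fun s hs => ?_) fun s hs => ?_
    · have := H _ HT.memH10
      rw [re_integral_formIntegrand_radialMap hA hφ hT HT] at this
      simp_rw [fun x => formComb_congr (A x) (fun j s hs => hφ.levelCoef_comp (hk n) j hs)
        (z x) (g x)] at this
      exact this
    · have := (hφ.sumMean_le ((hk n).pos s hs)).trans (softMin_le_left (hc n) hs)
      exact ((div_le_one hs).2 this).trans (by linarith)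
    · have hy := (hk n).pos s hs
      obtain ⟨k1, k2⟩ := hK _ hy (softMin_le_right (hc n) hs)
      have h1 := (div_le_one hs).2
        ((hφ.sumMean_le ((hk n).pos s hs)).trans (softMin_le_left (hc n) hs))
      have h2 := two_mul_sumMeanLog φ (softMin ((n : ℝ) + 1) s)
      have h3 := hφ.sumMeanLog_pos hy
      have h4 := softMin_log_nonneg (hc n) hs
      have h5 := softMin_log_le_one (hc n) hs
      have h6 : 0 ≤ sumMean φ (softMin ((n : ℝ) + 1) s) / s := (div_pos (hT.pos s hs) hs).le
      rw [abs_of_nonneg (mul_nonneg (mul_nonneg h3.le h4) h6)]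
      calc _ ≤ (K * 1) * 1 := mul_le_mul (mul_le_mul (by linarith) h5 h4 hK0.le) h1 h6
            (by positivity)
        _ ≤ 1 + K := by linarith

/-! ### Necessity: from dissipativity to the form. -/

/-- Every profile factors through `sumMean φ`, boundedly where it is bounded. -/
theorem Admissible.exists_profile_sumMean_eq {φ : ℝ → ℝ} (hφ : Admissible φ) {k κ : ℝ → ℝ}
    (hk : IsProfile k κ) : ∃ η θ : ℝ → ℝ, IsProfile η θ ∧ (∀ s, 0 < s → sumMean φ (η s) = k s) ∧
      (∀ s, 0 < s → sumMeanLog φ (η s) * θ s = κ s) ∧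
      ∀ M, 0 < M → ∃ M', ∀ s, 0 < s → k s ≤ M → η s ≤ M' := by
  -- The preimage of `t` under `sumMean` is `s + sφ(s)` with `s = ζ(t)`.
  have hη := hφ.isProfile_sum.comp (hφ.isProfile_zeta.comp hk)
  have he : ∀ s, 0 < s → sumMean φ (zeta φ (k s) + zeta φ (k s) * φ (zeta φ (k s))) = k s := by
    intro s hs
    have hks := hk.pos s hs
    rw [sumMean, hφ.sumInv_apply (hφ.isProfile_zeta.pos _ hks), hφ.apply_zeta hks]
  refine ⟨_, _, hη, he, fun s hs =>
    (hφ.isProfile_sumMean.comp hη).logDeriv_unique hk he hs,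
    fun M hM => ⟨zeta φ M + zeta φ M * φ (zeta φ M), fun s hs hsM => ?_⟩⟩
  have hks := hk.pos s hs
  have hzm : StrictMonoOn (zeta φ) (Ioi 0) := hφ.isProfile_zeta.strictMonoOn fun t ht =>
    one_div_pos.2 (by linarith [hφ.logDer_half_pos (hφ.isProfile_zeta.pos t ht)])
  have hsm := hφ.isProfile_sum.strictMonoOn fun _ => hφ.sum_logDer_pos
  exact hsm.monotoneOn (hφ.isProfile_zeta.pos _ hks) (hφ.isProfile_zeta.pos _ hM)
    (hzm.monotoneOn hks hM hsM)

/-- With `v` truncated at height `M`, the modulus `η` of the corresponding `u + φ(|u|)u` is bounded,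
so the logarithmic derivatives are too; but `η` need not be `O(s)` at 0. Replacing `η` by
`harmonicMin c η ≤ c s` puts `u` and `φ(|u|)u` in `H̊¹`, and then `c → ∞`. -/
theorem LPhiDissipative.re_integral_formComb_softMin_nonneg
    {A : Space N → Matrix (Fin N) (Fin N) ℂ} (hA : BoundedCoefficients Ω A) {φ : ℝ → ℝ}
    (hφ : Admissible φ) (H : LPhiDissipative Ω A φ) {v : Space N → ℂ} {g : Space N → Fin N → ℂ}
    (h : HasH10Grad Ω v g) {M : ℝ} (hM : 0 < M) :
    0 ≤ (∫ x in (Ω : Set (Space N)), formComb (A x)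
      (levelCoef (Lambda φ) (softMin M) (fun s => M / (s + M))) (v x) (g x)).re := by
  have hp := hφ.isProfile_sumInv
  have hq := hφ.isProfile_sumInv'
  have hk := isProfile_softMin hM
  obtain ⟨η, θ, hη, hηk, hθ, hbd⟩ := hφ.exists_profile_sumMean_eq hk
  obtain ⟨M', hM'⟩ := hbd M hM
  obtain ⟨K, hK0, hK⟩ := hφ.exists_sumInvLog_bound M'
  have hηM : ∀ s, 0 < s → η s ≤ M' := fun s hs => hM' s hs (softMin_le_right hM hs)
  have hθ0 : ∀ s, 0 < s → 0 ≤ θ s := by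
    intro s hs
    have h1 : 0 ≤ sumMeanLog φ (η s) * θ s := by
      rw [hθ s hs]
      exact softMin_log_nonneg hM hs
    exact nonneg_of_mul_nonneg_right h1 (hφ.sumMeanLog_pos (hη.pos s hs))
  -- As `1 ± Λ ≤ 2` and the logarithmic derivative of `softMin M` is at most 1, those of `sumInv ∘
  -- η` and `sumInv' ∘ η` are at most 2; `θ` is their mean with weights `sumInv` and `sumInv'`,
  -- whose sum is `η`.
  have hθ2 : ∀ s, 0 < s → θ s ≤ 2 := by
    intro s hs
    have hy := hη.pos s hs
    have e1 := hφ.one_add_Lambda_mul hy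
    have e2 := hφ.one_sub_Lambda_mul hy
    rw [hηk s hs] at e1 e2
    have hL := abs_le.1 (hφ.abs_Lambda_le (hk.pos s hs))
    have hκ : sumMeanLog φ (η s) * θ s ≤ 1 := by
      rw [hθ s hs]
      exact softMin_log_le_one hM hs
    have hκ0 : 0 ≤ sumMeanLog φ (η s) * θ s :=
      mul_nonneg (hφ.sumMeanLog_pos hy).le (hθ0 s hs)
    have hpp := hp.pos _ hy
    have hqp := hq.pos _ hy
    have hadd := hφ.sumInvLog_add hy
    have hsum := hφ.sumInv_add hy
    have b1 : sumInvLog φ (η s) * θ s ≤ 2 := by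
      rw [← e1, mul_assoc]
      nlinarith
    have b2 : sumInvLog' φ (η s) * θ s ≤ 2 := by
      rw [← e2, mul_assoc]
      nlinarith
    have e3 : θ s * η s = sumInvLog φ (η s) * θ s * sumInv φ (η s) +
        sumInvLog' φ (η s) * θ s * sumInv' φ (η s) := by
      linear_combination -θ s * hadd
    have b3 : θ s * η s ≤ 2 * η s := by
      rw [e3]
      nlinarith
    exact le_of_mul_le_mul_right b3 hy
  have hcoef : ∀ j s, 0 < s → levelCoef (Lambda φ) (softMin M) (fun s => M / (s + M)) j s =
      pairCoef (fun s => sumInv φ (η s)) (fun s => sumInvLog φ (η s) * θ s)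
        (fun s => sumInv' φ (η s)) (fun s => sumInvLog' φ (η s) * θ s) j s := by
    intro j s hs
    rw [← hφ.levelCoef_comp hη j hs]
    have e1 := hηk s hs
    have e2 := hθ s hs
    fin_cases j <;> simp only [levelCoef, Fin.zero_eta, Fin.mk_one, Fin.reduceFinMk,
      Matrix.cons_val, Matrix.cons_val_zero, Matrix.cons_val_one, e1, e2]
  simp_rw [fun x => formComb_congr (A x) hcoef (v x) (g x)]
  have hc : ∀ n : ℕ, (0 : ℝ) < (n : ℝ) + 1 := fun n => by positivity
  have hY := fun n : ℕ => hη.harmonicMin (hc n)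
  have hlog0 : ∀ (n : ℕ) s, 0 < s →
      0 ≤ (θ s * (((n : ℝ) + 1) * s) + η s) / (η s + ((n : ℝ) + 1) * s) := by
    intro n s hs
    have h1 := hη.pos s hs
    have h2 := hθ0 s hs
    have h3 := hc n
    positivity
  have hlog2 : ∀ (n : ℕ) s, 0 < s →
      (θ s * (((n : ℝ) + 1) * s) + η s) / (η s + ((n : ℝ) + 1) * s) ≤ 2 := by
    intro n s hs
    have h1 := hη.pos s hs
    have h3 : 0 < ((n : ℝ) + 1) * s := mul_pos (hc n) hs
    rw [div_le_iff₀ (by positivity)]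
    nlinarith [hθ2 s hs]
  have hYη : ∀ (n : ℕ) s, 0 < s → harmonicMin ((n : ℝ) + 1) η s ≤ η s := fun n s hs =>
    harmonicMin_le_left (hη.pos s hs) (hc n) hs
  have hYs : ∀ (n : ℕ) s, 0 < s → harmonicMin ((n : ℝ) + 1) η s ≤ ((n : ℝ) + 1) * s :=
    fun n s hs => harmonicMin_le_right (hη.pos s hs) (hc n) hs
  -- Each logarithmic derivative is at most `K · 2`; the extra 1 lets the same bound cover the
  -- coefficients in which one is absent. The product of the moduli over `s²` is at most 1, by
  -- monotonicity and `sumMean φ (η s) = softMin M s ≤ s`.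
  refine h.integral_formComb_nonneg_of_tendsto hA (K := (1 + 2 * K) ^ 2)
    (cn := fun n => pairCoef (fun s => sumInv φ (harmonicMin ((n : ℝ) + 1) η s))
      (fun s => sumInvLog φ (harmonicMin ((n : ℝ) + 1) η s) *
        ((θ s * (((n : ℝ) + 1) * s) + η s) / (η s + ((n : ℝ) + 1) * s)))
      (fun s => sumInv' φ (harmonicMin ((n : ℝ) + 1) η s))
      (fun s => sumInvLog' φ (harmonicMin ((n : ℝ) + 1) η s) *
        ((θ s * (((n : ℝ) + 1) * s) + η s) / (η s + ((n : ℝ) + 1) * s))))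
    (fun n => continuousOn_pairCoef (hp.comp (hY n)) (hq.comp (hY n))) ?_ ?_ ?_
  · intro n j s hs
    have hy := (hY n).pos s hs
    have hyη := hYη n s hs
    have l0 := hlog0 n s hs
    have l2 := hlog2 n s hs
    obtain ⟨k1, k2⟩ := hK _ hy (hyη.trans (hηM s hs))
    have m1 := (hp.strictMonoOn fun _ => hφ.sumInvLog_pos).monotoneOn hy (hη.pos s hs) hyη
    have m2 := (hq.strictMonoOn fun _ => hφ.sumInvLog'_pos).monotoneOn hy (hη.pos s hs) hyη
    set y := harmonicMin ((n : ℝ) + 1) η s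
    set d := (θ s * (((n : ℝ) + 1) * s) + η s) / (η s + ((n : ℝ) + 1) * s)
    have b0 : 0 ≤ sumInv φ y / s * (sumInv' φ y / s) :=
      (mul_pos (div_pos (hp.pos y hy) hs) (div_pos (hq.pos y hy) hs)).le
    have b1 : sumInv φ y / s * (sumInv' φ y / s) ≤ 1 := by
      rw [div_mul_div_comm, div_le_one (by positivity)]
      calc _ ≤ sumInv φ (η s) * sumInv' φ (η s) :=
            mul_le_mul m1 m2 (hq.pos y hy).le (hp.pos _ (hη.pos s hs)).le
        _ = softMin M s ^ 2 := by rw [← hφ.sumMean_sq (hη.pos s hs), hηk s hs]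
        _ ≤ s ^ 2 := pow_le_pow_left₀ (hk.pos s hs).le (softMin_le_left hM hs) 2
        _ = s * s := sq s
    have p0 : 0 ≤ sumInvLog φ y * d := mul_nonneg (hφ.sumInvLog_pos hy).le l0
    have q0 : 0 ≤ sumInvLog' φ y * d := mul_nonneg (hφ.sumInvLog'_pos hy).le l0
    have p1 : sumInvLog φ y * d ≤ 1 + 2 * K := by
      have := mul_le_mul k1 l2 l0 hK0.le
      linarith
    have q1 : sumInvLog' φ y * d ≤ 1 + 2 * K := by
      have := mul_le_mul k2 l2 l0 hK0.le
      linarith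
    have hK1 : 1 ≤ 1 + 2 * K := by linarith
    have hab : ∀ a b : ℝ, 0 ≤ a → 0 ≤ b → a ≤ 1 + 2 * K → b ≤ 1 + 2 * K →
        |a * b * (sumInv φ y / s * (sumInv' φ y / s))| ≤ (1 + 2 * K) ^ 2 := by
      intro a b ha hb ha' hb'
      rw [abs_of_nonneg (mul_nonneg (mul_nonneg ha hb) b0), sq]
      exact (mul_le_of_le_one_right (mul_nonneg ha hb) b1).trans
        (mul_le_mul ha' hb' hb (by linarith))
    fin_cases j
    · exact hab _ _ p0 q0 p1 q1
    · simpa [pairCoef] using hab 1 1 zero_le_one zero_le_one hK1 hK1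
    · simpa [pairCoef] using hab _ 1 p0 zero_le_one p1 hK1
    · simpa [pairCoef] using hab _ 1 q0 zero_le_one q1 hK1
  · intro j s hs
    have hy := hη.pos s hs
    have t1 := tendsto_harmonicMin η hs
    have t2 := tendsto_harmonicMin_logDeriv (θ s) (η s) hs
    refine tendsto_pairCoef ?_ ?_ ?_ ?_ j
    · exact (hp.continuousAt_left hy).tendsto.comp t1
    · exact ((hp.continuousAt hy).tendsto.comp t1).mul t2
    · exact (hq.continuousAt_left hy).tendsto.comp t1
    · exact ((hq.continuousAt hy).tendsto.comp t1).mul t2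
  · intro n
    -- The radial derivative is at most `d y/s`, where `d ≤ 2` is the logarithmic derivative of the
    -- damped modulus `y ≤ (n + 1)s`.
    have hbound : ∀ (a b y s d : ℝ), 0 < s → 0 ≤ a → 0 ≤ b → 0 ≤ d → d ≤ 2 → a * b ≤ y →
        y ≤ ((n : ℝ) + 1) * s → |a * d * (b / s)| ≤ 2 * ((n : ℝ) + 1) := by
      intro a b y s d hs ha hb hd hd2 hab hys
      rw [abs_of_nonneg (mul_nonneg (mul_nonneg ha hd) (div_nonneg hb hs.le)), mul_div_assoc',
        div_le_iff₀ hs]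
      nlinarith [mul_nonneg ha hb, mul_pos (hc n) hs]
    have hP := hp.comp (hY n)
    have hR := hq.comp (hY n)
    have HP := h.radial hP (K := 2 * ((n : ℝ) + 1))
      (fun s hs => by
        rw [div_le_iff₀ hs]
        nlinarith [(hφ.sumInv_le ((hY n).pos s hs)).trans (hYs n s hs), mul_pos (hc n) hs])
      (fun s hs => hbound _ _ _ s _ hs (hφ.sumInvLog_pos ((hY n).pos s hs)).le (hP.pos s hs).le
        (hlog0 n s hs) (hlog2 n s hs) (hφ.sumInvLog_mul_le ((hY n).pos s hs)) (hYs n s hs))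
    have HR := h.radial hR (K := 2 * ((n : ℝ) + 1))
      (fun s hs => by
        rw [div_le_iff₀ hs]
        nlinarith [(hφ.sumInv'_le ((hY n).pos s hs)).trans (hYs n s hs), mul_pos (hc n) hs])
      (fun s hs => hbound _ _ _ s _ hs (hφ.sumInvLog'_pos ((hY n).pos s hs)).le (hR.pos s hs).le
        (hlog0 n s hs) (hlog2 n s hs) (hφ.sumInvLog'_mul_le ((hY n).pos s hs)) (hYs n s hs))
    have hw : phiMul φ (fun x => radialMap (fun s => sumInv φ (harmonicMin ((n : ℝ) + 1) η s)) (v x))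
        = fun x => radialMap (fun s => sumInv' φ (harmonicMin ((n : ℝ) + 1) η s)) (v x) := by
      ext x
      by_cases hx : v x = 0
      · simp [phiMul, hx]
      · rw [phiMul, norm_radialMap hP hx, radialMap_eq, radialMap_eq, sumInv']
        push_cast
        ring
    have := H _ HP.memH10 (by rw [hw]; exact HR.memH10)
    rw [hw, HasH10Grad.integral_cinner_radialMap A HP HR] at this
    exact this

theorem LPhiDissipative.re_integral_formIntegrand_nonneg
    {A : Space N → Matrix (Fin N) (Fin N) ℂ} (hA : BoundedCoefficients Ω A) {φ : ℝ → ℝ}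
    (hφ : Admissible φ) (H : LPhiDissipative Ω A φ) {v : Space N → ℂ} (hv : MemH10 Ω v) :
    0 ≤ (∫ x in (Ω : Set (Space N)), formIntegrand Ω A φ v x).re := by
  have h := hv.hasH10Grad
  rw [h.re_integral_formIntegrand hA hφ]
  have hc : ∀ n : ℕ, (0 : ℝ) < (n : ℝ) + 1 := fun n => by positivity
  have hk := fun n : ℕ => isProfile_softMin (hc n)
  have hL := hφ.continuousOn_Lambda
  -- Removal of the truncation `M = n + 1`: since `|Λ| ≤ 1`, the factors `1 - Λ²` and `1 ± Λ` are at
  -- most 2, and the remaining factors are at most 1.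
  refine h.integral_formComb_nonneg_of_tendsto hA (K := 2)
    (cn := fun n => levelCoef (Lambda φ) (softMin ((n : ℝ) + 1))
      (fun s => ((n : ℝ) + 1) / (s + ((n : ℝ) + 1)))) ?_ ?_ ?_
    fun n => H.re_integral_formComb_softMin_nonneg hA hφ h (hc n)
  · intro n j
    have c1 : ContinuousOn (fun s => Lambda φ (softMin ((n : ℝ) + 1) s)) (Ioi 0) :=
      hL.comp (hk n).continuousOn_left fun s hs => (hk n).pos s hs
    have c2 := (hk n).continuousOn
    have c3 : ContinuousOn (fun s => (softMin ((n : ℝ) + 1) s / s) ^ 2) (Ioi 0) :=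
      ((hk n).continuousOn_left.div continuousOn_id fun s hs => ne_of_gt hs).pow 2
    fin_cases j
    · exact ((continuousOn_const.sub (c1.pow 2)).mul (c2.pow 2)).mul c3
    · exact c3
    · exact ((continuousOn_const.add c1).mul c2).mul c3
    · exact ((continuousOn_const.sub c1).mul c2).mul c3
  · intro n j s hs
    have hy := (hk n).pos s hs
    have hLb := abs_le.1 (hφ.abs_Lambda_le hy)
    have r0 : 0 ≤ softMin ((n : ℝ) + 1) s / s := (div_pos hy hs).le
    have r1 : softMin ((n : ℝ) + 1) s / s ≤ 1 := (div_le_one hs).2 (softMin_le_left (hc n) hs)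
    have l0 := softMin_log_nonneg (hc n) hs
    have l1 := softMin_log_le_one (hc n) hs
    have hab : ∀ a b c : ℝ, 0 ≤ a → a ≤ 2 → 0 ≤ b → b ≤ 1 → 0 ≤ c → c ≤ 1 →
        |a * b * c| ≤ 2 := by
      intro a b c ha ha2 hb hb1 hc hc1
      rw [abs_of_nonneg (mul_nonneg (mul_nonneg ha hb) hc)]
      exact (mul_le_of_le_one_right (mul_nonneg ha hb) hc1).trans
        ((mul_le_of_le_one_right ha hb1).trans ha2)
    have q0 := sq_nonneg (softMin ((n : ℝ) + 1) s / s)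
    have q1 := pow_le_one₀ r0 r1 (n := 2)
    fin_cases j
    · exact hab _ _ _ (by nlinarith) (by nlinarith) (sq_nonneg _) (pow_le_one₀ l0 l1) q0 q1
    · simpa [levelCoef] using hab 1 1 _ zero_le_one one_le_two zero_le_one le_rfl q0 q1
    · exact hab _ _ _ (by linarith) (by linarith) l0 l1 q0 q1
    · exact hab _ _ _ (by linarith) (by linarith) l0 l1 q0 q1
  · intro j s hs
    have t1 := tendsto_softMin s
    have t2 := tendsto_div_add_nat s
    have t3 := (hL.continuousAt (Ioi_mem_nhds hs)).tendsto.comp t1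
    have t4 := (t1.div_const s).pow 2
    fin_cases j
    · exact ((t3.pow 2).const_sub 1 |>.mul (t2.pow 2)).mul t4
    · exact t4
    · exact ((t3.const_add 1).mul t2).mul t4
    · exact ((t3.const_sub 1).mul t2).mul t4

end FunctionalDissipativity

end

theorem lemma5p1 {N : ℕ} (Ω : TopologicalSpace.Opens (FunctionalDissipativity.Space N))
    (A : FunctionalDissipativity.Space N → Matrix (Fin N) (Fin N) ℂ)
    (hA : FunctionalDissipativity.BoundedCoefficients Ω A)
    (φ : ℝ → ℝ) (hφ : FunctionalDissipativity.Admissible φ) :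
    FunctionalDissipativity.LPhiDissipative Ω A φ ↔
      ∀ v : FunctionalDissipativity.Space N → ℂ, FunctionalDissipativity.MemH10 Ω v →
        0 ≤ (∫ x in (Ω : Set (FunctionalDissipativity.Space N)),
          FunctionalDissipativity.formIntegrand Ω A φ v x).re :=
  ⟨fun H _ hv => H.re_integral_formIntegrand_nonneg hA hφ hv,
    fun H => FunctionalDissipativity.lPhiDissipative_of_formIntegrand_nonneg hA hφ H⟩
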